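/- Let $M$ be a compact smooth $n$-dimensional manifold (without boundary), let $\varphi:M\to\mathbb{R}^{n+1}$ be a smooth immersion, and let $\mu$ be the canonical measure on $M$ of the Riemannian metric induced by $\varphi$. For $\tau>0$ let $\mathcal F_\tau$ be the family of smooth positive functions $u:\mathbb{R}^{n+1}\to\mathbb{R}$ such that $\int_{\mathbb{R}^{n+1}}u\,dx=1$ and such that there is a smooth positive solution $v$ of the backward heat equation $v_t=-\Delta v$ in $\mathbb{R}^{n+1}\times[0,\tau)$ with $v(x,0)=u(x)$ for every $x\in\mathbb{R}^{n+1}$. Put $$\sigma(\varphi,\tau)=\sup_{u\in\mathcal F_\tau}\sqrt{4\pi\tau}\int_M u(\varphi(q))\,d\mu(q).$$ Then, for every $\tau>0$, all these integrals converge, the supremum is finite, and $$\sigma(\varphi,\tau)=\max_{p\in\mathbb{R}^{n+1}}\int_M\frac{e^{-|\varphi(q)-p|^2/4\tau}}{(4\pi\tau)^{n/2}}\,d\mu(q),$$ where the maximum over $p$ exists. In particular, the supremum defining $\sigma(\varphi,\tau)$ is attained at a heat kernel: there is $p\in\mathbb{R}^{n+1}$ such that the function $K(x)=(4\pi\tau)^{-(n+1)/2}e^{-|x-p|^2/4\tau}$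 belongs to $\mathcal F_\tau$ and $\sqrt{4\pi\tau}\int_M K(\varphi(q))\,d\mu(q)=\sigma(\varphi,\tau)$. -/

import Mathlib

open Set MeasureTheory
open scoped Manifold ContDiff InnerProductSpace Laplacian

/-- Euclidean space of dimension `k`. -/
abbrev Euc (k : ℕ) : Type := EuclideanSpace ℝ (Fin k)

section Area

/-- The matrix of the metric induced by `f` on its domain of parameters, at the point `y`:
`g i j = ⟪∂ᵢ f, ∂ⱼ f⟫`. -/
noncomputable def inducedMetric {n k : ℕ} (f : Euc n → Euc k) (y : Euc n) :
    Matrix (Fin n) (Fin n) ℝ :=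
  Matrix.gram ℝ fun i => fderiv ℝ f y (EuclideanSpace.single i 1)

/-- The density `√(det g)` of the Riemannian area element of the metric induced by `f`. -/
noncomputable def areaDensity {n k : ℕ} (f : Euc n → Euc k) (y : Euc n) : ENNReal :=
  ENNReal.ofReal √(inducedMetric f y).det

/-- The area measure of the metric induced by `φ`, on the domain of the preferred chart at `q`
(and zero outside): the image under the inverse of the chart of `√(det g) dy`. -/
noncomputable def chartArea {n k : ℕ} {M : Type*} [TopologicalSpace M] [ChartedSpace (Euc n) M]
    [MeasurableSpace M] (φ : M → Euc k) (q : M) : Measure M :=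
  ((volume.restrict (chartAt (Euc n) q).target).withDensity
    (areaDensity (φ ∘ (chartAt (Euc n) q).symm))).map (chartAt (Euc n) q).symm

/-- The canonical measure `μ` on `M` of the Riemannian metric induced by `φ`. The measures
`√(det g) dy` in the various charts agree on overlaps, and `μ` is the measure glued from them, that
is, the least measure which dominates all of them; see `inducedArea_restrict_source`. -/
noncomputable def inducedArea {n k : ℕ} {M : Type*} [TopologicalSpace M] [ChartedSpace (Euc n) M]
    [MeasurableSpace M] (φ : M → Euc k) : Measure M :=
  ⨆ q : M, chartArea (n := n) φ q

variable {n k : ℕ} {M : Type*} [TopologicalSpace M] [ChartedSpace (Euc n) M]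
  [MeasurableSpace M]

variable {n k : ℕ} {M : Type*} [TopologicalSpace M] [ChartedSpace (Euc n) M]
    [MeasurableSpace M]
/-- The area density transforms by the Jacobian determinant under a change of parameters. -/
lemma areaDensity_comp {n k : ℕ} {f : Euc n → Euc k} {T : Euc n → Euc n} {y : Euc n}
    (hf : DifferentiableAt ℝ f (T y)) (hT : DifferentiableAt ℝ T y) :
    areaDensity (f ∘ T) y = ENNReal.ofReal |(fderiv ℝ T y).det| * areaDensity f (T y) := by
  unfold areaDensity
  rw [← ENNReal.ofReal_mul (abs_nonneg _)]
  congr 1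
  have key : inducedMetric (f ∘ T) y =
      (LinearMap.toMatrix (EuclideanSpace.basisFun (Fin n) ℝ).toBasis
        (EuclideanSpace.basisFun (Fin n) ℝ).toBasis (fderiv ℝ T y : Euc n →ₗ[ℝ] Euc n)).transpose *
      inducedMetric f (T y) *
      (LinearMap.toMatrix (EuclideanSpace.basisFun (Fin n) ℝ).toBasis
        (EuclideanSpace.basisFun (Fin n) ℝ).toBasis (fderiv ℝ T y : Euc n →ₗ[ℝ] Euc n)) := by
    have hv : ∀ v : Euc n, v = ∑ i, v i • EuclideanSpace.single i (1 : ℝ) := by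
      intro v
      ext j
      simp [Finset.sum_apply, Pi.single_apply]
    ext i j
    simp only [inducedMetric, Matrix.gram_apply, Matrix.mul_apply, Matrix.transpose_apply]
    rw [fderiv_comp y hf hT]
    simp only [ContinuousLinearMap.comp_apply]
    conv_lhs => rw [hv (fderiv ℝ T y (EuclideanSpace.single i 1)),
      hv (fderiv ℝ T y (EuclideanSpace.single j 1))]
    simp only [map_sum, map_smul, sum_inner, inner_sum, inner_smul_left, inner_smul_right,
      LinearMap.toMatrix_apply]
    simp only [OrthonormalBasis.coe_toBasis, EuclideanSpace.basisFun_apply,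
      ContinuousLinearMap.coe_coe, OrthonormalBasis.coe_toBasis_repr_apply,
      EuclideanSpace.basisFun_repr, RCLike.conj_to_real, Finset.sum_mul]
    simp only [Finset.mul_sum]
    refine Finset.sum_congr rfl fun a _ => Finset.sum_congr rfl fun b _ => by
      rw [real_inner_comm]; ring
  rw [key, Matrix.det_mul, Matrix.det_mul, Matrix.det_transpose, LinearMap.det_toMatrix,
    show ∀ a b : ℝ, a * b * a = a ^ 2 * b by intros; ring, Real.sqrt_mul (sq_nonneg _),
    Real.sqrt_sq_eq_abs]

variable [BorelSpace M]

lemma chartArea_apply (φ : M → Euc k) (q : M) {s : Set M} (hs : MeasurableSet s) :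
    chartArea (n := n) φ q s = ∫⁻ y in (chartAt (Euc n) q).target ∩ (chartAt (Euc n) q).symm ⁻¹' s,
      areaDensity (φ ∘ (chartAt (Euc n) q).symm) y := by
  set c := chartAt (Euc n) q
  have hm : AEMeasurable c.symm (volume.restrict c.target) :=
    c.continuousOn_symm.aemeasurable c.open_target.measurableSet
  have hnull : NullMeasurableSet (c.symm ⁻¹' s) (volume.restrict c.target) :=
    hm.nullMeasurable hs
  rw [chartArea, Measure.map_apply_of_aemeasurable (hm.mono_ac (withDensity_absolutelyContinuous _ _)) hs,
    withDensity_apply₀ _ hnull, Measure.restrict_restrict₀ hnull, inter_comm]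

/-- The chart areas agree on overlaps. -/
lemma chartArea_congr [IsManifold (𝓡 n) ∞ M] {φ : M → Euc k} (hφ : ContMDiff (𝓡 n) (𝓡 k) ∞ φ)
    (q r : M) {s : Set M} (hs : MeasurableSet s) (hq : s ⊆ (chartAt (Euc n) q).source)
    (hr : s ⊆ (chartAt (Euc n) r).source) :
    chartArea (n := n) φ q s = chartArea (n := n) φ r s := by
  rw [chartArea_apply φ q hs, chartArea_apply φ r hs]
  set c := chartAt (Euc n) q
  set d := chartAt (Euc n) r
  set S := c.target ∩ c.symm ⁻¹' s
  set T : Euc n → Euc n := d ∘ c.symm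
  have hS : MeasurableSet S := by
    have h := (continuousOn_iff_continuous_domRestrict.1 c.continuousOn_symm).measurable hs
    have h' := c.open_target.measurableSet.subtype_image h
    convert h' using 1
    ext y
    simp [S, and_comm]
  have himg : d.target ∩ d.symm ⁻¹' s = T '' S := by
    ext z
    constructor
    · rintro ⟨hz, hzs⟩
      refine ⟨c (d.symm z), ⟨c.map_source (hq hzs), ?_⟩, ?_⟩
      · simpa [c.left_inv (hq hzs)] using hzs
      · simp [T, c.left_inv (hq hzs), d.right_inv hz]
    · rintro ⟨y, ⟨hy, hys⟩, rfl⟩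
      refine ⟨d.map_source (hr hys), ?_⟩
      simpa [T, d.left_inv (hr hys)] using hys
  have hinj : InjOn T S := by
    rintro y ⟨hy, hys⟩ z ⟨hz, hzs⟩ h
    exact c.symm.injOn hy hz (d.injOn (hr hys) (hr hzs) h)
  have hTd : ∀ y ∈ S, DifferentiableAt ℝ T y := by
    rintro y ⟨hy, hys⟩
    have h1 : ContMDiffAt (𝓡 n) (𝓡 n) ∞ T y :=
      (contMDiffAt_of_mem_maximalAtlas (IsManifold.chart_mem_maximalAtlas r) (hr hys)).comp y
        (contMDiffAt_symm_of_mem_maximalAtlas (IsManifold.chart_mem_maximalAtlas q) hy)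
    exact h1.contDiffAt.differentiableAt (by simp)
  have hfd : ∀ y ∈ S, DifferentiableAt ℝ (φ ∘ d.symm) (T y) := by
    rintro y ⟨hy, hys⟩
    have h1 : ContMDiffAt (𝓡 n) (𝓡 k) ∞ (φ ∘ d.symm) (T y) :=
      hφ.contMDiffAt.comp (T y)
        (contMDiffAt_symm_of_mem_maximalAtlas (IsManifold.chart_mem_maximalAtlas r)
          (d.map_source (hr hys)))
    exact h1.contDiffAt.differentiableAt (by simp)
  rw [himg, lintegral_image_eq_lintegral_abs_det_fderiv_mul volume hS
    (fun y hy => (hTd y hy).hasFDerivAt.hasFDerivWithinAt) hinj]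
  refine setLIntegral_congr_fun hS fun y hy => ?_
  rw [← areaDensity_comp (hfd y hy) (hTd y hy)]
  have : φ ∘ c.symm =ᶠ[nhds y] (φ ∘ d.symm) ∘ T := by
    have h1 : ∀ᶠ z in nhds y, c.symm z ∈ d.source :=
      (c.continuousAt_symm hy.1).preimage_mem_nhds (d.open_source.mem_nhds (hr hy.2))
    filter_upwards [h1] with z hz
    simp [T, d.left_inv hz]
  simp only [areaDensity, inducedMetric, this.fderiv_eq]

lemma chartArea_compl (φ : M → Euc k) (q : M) :
    chartArea (n := n) φ q (chartAt (Euc n) q).sourceᶜ = 0 := by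
  rw [chartArea_apply φ q (chartAt (Euc n) q).open_source.measurableSet.compl]
  convert setLIntegral_empty _
  ext y
  simp only [mem_inter_iff, mem_preimage, mem_compl_iff, mem_empty_iff_false, iff_false]
  rintro ⟨h1, h2⟩
  exact h2 ((chartAt (Euc n) q).map_target h1)

/-- In each chart, the induced area is `√(det g) dy`. -/
theorem inducedArea_restrict_source [IsManifold (𝓡 n) ∞ M] {φ : M → Euc k}
    (hφ : ContMDiff (𝓡 n) (𝓡 k) ∞ φ) (q : M) :
    (inducedArea (n := n) φ).restrict (chartAt (Euc n) q).source = chartArea (n := n) φ q := by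
  have hU : ∀ r : M, MeasurableSet (chartAt (Euc n) r).source :=
    fun r => (chartAt (Euc n) r).open_source.measurableSet
  apply le_antisymm
  · have h : inducedArea (n := n) φ ≤ chartArea (n := n) φ q +
        (inducedArea (n := n) φ).restrict (chartAt (Euc n) q).sourceᶜ := by
      refine iSup_le fun r => Measure.le_iff.2 fun s hs => ?_
      rw [← measure_inter_add_sdiff s (hU q), Measure.add_apply, Measure.restrict_apply hs]
      refine add_le_add ?_ (le_iSup (fun q : M => chartArea (n := n) φ q) r _)
      have h1 : chartArea (n := n) φ r (s ∩ (chartAt (Euc n) q).source) =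
          chartArea (n := n) φ r (s ∩ (chartAt (Euc n) q).source ∩ (chartAt (Euc n) r).source) := by
        rw [measure_inter_conull (chartArea_compl φ r)]
      rw [h1, chartArea_congr hφ r q ((hs.inter (hU q)).inter (hU r)) inter_subset_right
        (inter_subset_left.trans inter_subset_right)]
      exact measure_mono (inter_subset_left.trans inter_subset_left)
    refine Measure.le_iff.2 fun s hs => ?_
    rw [Measure.restrict_apply hs]
    refine (h _).trans ?_
    rw [Measure.add_apply, Measure.restrict_apply (hs.inter (hU q)), inter_assoc, inter_compl_self,
      inter_empty, measure_empty, add_zero]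
    exact measure_mono inter_subset_left
  · refine Measure.le_iff.2 fun s hs => ?_
    rw [Measure.restrict_apply hs, ← measure_inter_conull (chartArea_compl φ q)]
    exact le_iSup (fun q : M => chartArea (n := n) φ q) q _

/-- The induced area of a compact manifold is finite. -/
theorem isFiniteMeasure_inducedArea [IsManifold (𝓡 n) ∞ M] [CompactSpace M] {φ : M → Euc k}
    (hφ : ContMDiff (𝓡 n) (𝓡 k) ∞ φ) : IsFiniteMeasure (inducedArea (n := n) φ) := by
  have : IsLocallyFiniteMeasure (inducedArea (n := n) φ) := by
    refine ⟨fun q => ?_⟩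
    set c := chartAt (Euc n) q
    have hq : c q ∈ c.target := c.map_source (mem_chart_source _ q)
    have hsm : ContDiffOn ℝ ∞ (φ ∘ c.symm) c.target := by
      rw [← contMDiffOn_iff_contDiffOn]
      exact hφ.comp_contMDiffOn
        (contMDiffOn_symm_of_mem_maximalAtlas (IsManifold.chart_mem_maximalAtlas q))
    have hcont : ContinuousOn (areaDensity (φ ∘ c.symm)) c.target := by
      have h1 : ContinuousOn (fderiv ℝ (φ ∘ c.symm)) c.target :=
        hsm.continuousOn_fderiv_of_isOpen c.open_target (by simp)
      have h2 : ContinuousOn (inducedMetric (φ ∘ c.symm)) c.target := by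
        refine continuousOn_pi.2 fun i => continuousOn_pi.2 fun j => ?_
        simp only [inducedMetric, Matrix.gram_apply]
        exact (h1.clm_apply continuousOn_const).inner (h1.clm_apply continuousOn_const)
      exact (ENNReal.continuous_ofReal.comp Real.continuous_sqrt).comp_continuousOn
        ((continuous_id.matrix_det).comp_continuousOn h2)
    have hlt : areaDensity (φ ∘ c.symm) (c q) < areaDensity (φ ∘ c.symm) (c q) + 1 :=
      ENNReal.lt_add_right ENNReal.ofReal_ne_top one_ne_zero
    set C := areaDensity (φ ∘ c.symm) (c q) + 1
    have hC : C ≠ ⊤ := ENNReal.add_ne_top.2 ⟨ENNReal.ofReal_ne_top, ENNReal.one_ne_top⟩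
    have hev : ∀ᶠ y in nhds (c q), y ∈ c.target ∧ areaDensity (φ ∘ c.symm) y < C :=
      Filter.Eventually.and (c.open_target.mem_nhds hq)
        ((hcont.continuousAt (c.open_target.mem_nhds hq)).eventually_lt_const hlt)
    obtain ⟨ε, hε, hball⟩ := Metric.eventually_nhds_iff_ball.1 hev
    refine ⟨c.source ∩ c ⁻¹' (Metric.ball (c q) ε),
      (c.isOpen_inter_preimage Metric.isOpen_ball).mem_nhds
        ⟨mem_chart_source _ q, Metric.mem_ball_self hε⟩, ?_⟩
    have hm := (c.isOpen_inter_preimage (s := Metric.ball (c q) ε) Metric.isOpen_ball).measurableSet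
    rw [← inter_self c.source, inter_assoc, inter_comm, ← Measure.restrict_apply hm,
      inducedArea_restrict_source hφ q, chartArea_apply φ q hm]
    calc _ ≤ ∫⁻ y in Metric.ball (c q) ε, areaDensity (φ ∘ c.symm) y := by
            refine lintegral_mono_set ?_
            rintro y ⟨hy, hy'⟩
            have h := hy'.2
            rwa [mem_preimage, c.right_inv hy] at h
      _ ≤ ∫⁻ _ in Metric.ball (c q) ε, C :=
            setLIntegral_mono' Metric.isOpen_ball.measurableSet fun y hy => (hball y hy).2.le
      _ < ⊤ := by
            rw [setLIntegral_const]
            exact ENNReal.mul_lt_top hC.lt_top measure_ball_lt_top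
  infer_instance

end Area

/-- `v`, as a function of `t` and `x`, is a smooth positive solution on `ℝᵐ × [0, τ)` of the
backward heat equation `∂v/∂t = -Δv`. At `t = 0`, smoothness is smoothness up to the boundary and
the time derivative is the one-sided one. -/
structure IsPositiveBackwardHeatSolution {m : ℕ} (τ : ℝ) (v : ℝ → Euc m → ℝ) : Prop where
  smooth : ContDiffOn ℝ ∞ (fun z : ℝ × Euc m => v z.1 z.2) (Ico 0 τ ×ˢ univ)
  pos : ∀ t ∈ Ico 0 τ, ∀ x, 0 < v t x
  eqn : ∀ t ∈ Ico 0 τ, ∀ x, HasDerivWithinAt (fun s => v s x) (-(Δ (v t)) x) (Ico 0 τ) t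

/-- The family `𝓕_τ` of the smooth positive functions `u` on `ℝᵐ` of integral `1` which are the
value at time `0` of a smooth positive solution of the backward heat equation on `ℝᵐ × [0, τ)`. -/
def admissibleFamily (m : ℕ) (τ : ℝ) : Set (Euc m → ℝ) :=
  {u | ContDiff ℝ ∞ u ∧ (∀ x, 0 < u x) ∧ Integrable u ∧ ∫ x, u x = 1 ∧
    ∃ v : ℝ → Euc m → ℝ, IsPositiveBackwardHeatSolution τ v ∧ ∀ x, v 0 x = u x}

/-- The heat kernel of `ℝᵐ` at time `τ` and point `p`. -/
noncomputable def heatKernel {m : ℕ} (p : Euc m) (τ : ℝ) (x : Euc m) : ℝ :=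
  Real.exp (-(‖x - p‖ ^ 2 / (4 * τ))) / (4 * Real.pi * τ) ^ ((m : ℝ) / 2)

section Functionals

variable {n : ℕ} {M : Type*} [TopologicalSpace M] [ChartedSpace (Euc n) M] [MeasurableSpace M]

/-- `√(4πτ) ∫_M u dμ`, for a function `u` on `ℝⁿ⁺¹` and a hypersurface `φ : M → ℝⁿ⁺¹`. -/
noncomputable def weightedArea (φ : M → Euc (n + 1)) (τ : ℝ) (u : Euc (n + 1) → ℝ) : ℝ :=
  √(4 * Real.pi * τ) * ∫ q, u (φ q) ∂(inducedArea (n := n) φ)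

/-- `σ(φ, τ)`, the supremum of `√(4πτ) ∫_M u dμ` over `u ∈ 𝓕_τ`. -/
noncomputable def sigma (φ : M → Euc (n + 1)) (τ : ℝ) : ℝ :=
  sSup (weightedArea φ τ '' admissibleFamily (n + 1) τ)

/-- The Huisken functional `∫_M (4πτ)^(-n/2) exp(-|x - p|² / 4τ) dμ(x)`. -/
noncomputable def huiskenFunctional (φ : M → Euc (n + 1)) (τ : ℝ) (p : Euc (n + 1)) : ℝ :=
  ∫ q, Real.exp (-(‖φ q - p‖ ^ 2 / (4 * τ))) / (4 * Real.pi * τ) ^ ((n : ℝ) / 2)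
    ∂(inducedArea (n := n) φ)

end Functionals

/-! Let `v` solve the backward equation with initial value `u`, and let `ε = τ - t`. Pairing `v`
with a forward heat kernel formally gives a constant of motion, so the convolution of `u` with the
kernel of time `ε` should equal that of `v t` with the kernel of time `t + ε = τ`. Since `v t` has
mass at most `1`, the smoothed `u` is then dominated by a superposition, of total weight at most
`1`, of heat kernels of time exactly `τ`. By Tonelli its weighted area over `M` is at most the
maximum of the Huisken functional, and Fatou lets `ε` tend to `0`: this is `weightedArea_le`.

No growth of `v` at infinity is assumed, so the pairing is done with compactly supported cutoffs of
parameter `k → 0`. Two one-sided estimates suffice, and no uniqueness theorem for positive solutions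
is needed: the mass does not exceed its initial value (`lintegral_le_one`), and the pairing with the
kernel at time `0` is at most the pairing at time `t` (`integral_mul_heatKernel_le`). The mass bound
controls the cutoff error in the second one.

Conversely, heat kernels of time `τ` are admissible, and their weighted area is the Huisken
functional. The latter is continuous and vanishes at infinity, hence has a maximum. -/

/-! ### The Laplacian: Green's identity and radial functions. -/

section Laplacian

variable {m : ℕ}

lemma laplacian_eq_sum_fderiv {f : Euc m → ℝ} {x : Euc m} (hf : ContDiffAt ℝ 2 f x) :
    (Δ f) x = ∑ i, fderiv ℝ (fun y => fderiv ℝ f y (EuclideanSpace.single i 1)) x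
      (EuclideanSpace.single i 1) := by
  rw [InnerProductSpace.laplacian_eq_iteratedFDeriv_orthonormalBasis f
    (EuclideanSpace.basisFun (Fin m) ℝ)]
  refine Finset.sum_congr rfl fun i _ => ?_
  rw [iteratedFDeriv_two_apply]
  have h : DifferentiableAt ℝ (fderiv ℝ f) x :=
    (hf.fderiv_right (m := 1) (by norm_num)).differentiableAt (by norm_num)
  rw [fderiv_clm_apply h (differentiableAt_const _)]
  simp

/-- Green's second identity without boundary terms. -/
lemma integral_laplacian_mul {f g : Euc m → ℝ} (hf : ContDiff ℝ 2 f) (hg : ContDiff ℝ 2 g)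
    (hgc : HasCompactSupport g) :
    ∫ x, (Δ f) x * g x = ∫ x, f x * (Δ g) x := by
  have d : ∀ {h : Euc m → ℝ} (_ : ContDiff ℝ 2 h) (w : Euc m),
      ContDiff ℝ 1 fun y => fderiv ℝ h y w := fun hh w =>
    (hh.fderiv_right (m := 1) (by norm_num)).clm_apply contDiff_const
  have d' : ∀ {h : Euc m → ℝ} (_ : ContDiff ℝ 2 h) (w : Euc m),
      Continuous fun x => fderiv ℝ (fun y => fderiv ℝ h y w) x w := fun hh w =>
    ((d hh w).continuous_fderiv (by norm_num)).clm_apply continuous_const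
  have gc : ∀ w, HasCompactSupport fun y => fderiv ℝ g y w := fun w => hgc.fderiv_apply ℝ w
  have gc' : ∀ w, HasCompactSupport fun x => fderiv ℝ (fun y => fderiv ℝ g y w) x w :=
    fun w => (gc w).fderiv_apply ℝ w
  have i0 : ∀ w, Integrable fun x => fderiv ℝ (fun y => fderiv ℝ f y w) x w * g x := fun w =>
    ((d' hf w).mul hg.continuous).integrable_of_hasCompactSupport hgc.mul_left
  have i1 : ∀ w, Integrable fun x => fderiv ℝ f x w * fderiv ℝ g x w := fun w =>
    ((d hf w).continuous.mul (d hg w).continuous).integrable_of_hasCompactSupport (gc w).mul_left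
  have i2 : ∀ w, Integrable fun x => f x * fderiv ℝ (fun y => fderiv ℝ g y w) x w := fun w =>
    (hf.continuous.mul (d' hg w)).integrable_of_hasCompactSupport (gc' w).mul_left
  have i3 : ∀ w, Integrable fun x => fderiv ℝ f x w * g x := fun w =>
    ((d hf w).continuous.mul hg.continuous).integrable_of_hasCompactSupport hgc.mul_left
  have i4 : ∀ w, Integrable fun x => f x * fderiv ℝ g x w := fun w =>
    (hf.continuous.mul (d hg w).continuous).integrable_of_hasCompactSupport (gc w).mul_left
  simp only [laplacian_eq_sum_fderiv hf.contDiffAt, laplacian_eq_sum_fderiv hg.contDiffAt,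
    Finset.sum_mul, Finset.mul_sum]
  rw [integral_finsetSum _ fun i _ => i0 _, integral_finsetSum _ fun i _ => i2 _]
  refine Finset.sum_congr rfl fun i _ => ?_
  set w : Euc m := EuclideanSpace.single i 1
  -- Two integrations by parts in each coordinate; the support of `g` alone makes every product
  -- integrable.
  have e1 := integral_mul_fderiv_eq_neg_fderiv_mul_of_integrable (i0 w) (i1 w) (i3 w)
    (fun x _ => (d hf w).differentiable (by norm_num) x)
    (fun x _ => hg.differentiable (by norm_num) x)
  have e2 := integral_mul_fderiv_eq_neg_fderiv_mul_of_integrable (i1 w) (i2 w) (i4 w)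
    (fun x _ => hf.differentiable (by norm_num) x)
    (fun x _ => (d hg w).differentiable (by norm_num) x)
  rw [e2, e1, neg_neg]

/-- The Laplacian of a function of the squared distance to a point. -/
lemma laplacian_comp_norm_sub_sq {g g₁ g₂ : ℝ → ℝ} (hg : ContDiff ℝ 2 g)
    (h₁ : ∀ r, HasDerivAt g (g₁ r) r) (h₂ : ∀ r, HasDerivAt g₁ (g₂ r) r) (p x : Euc m) :
    (Δ fun y => g (‖y - p‖ ^ 2)) x =
      4 * ‖x - p‖ ^ 2 * g₂ (‖x - p‖ ^ 2) + 2 * m * g₁ (‖x - p‖ ^ 2) := by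
  have hn : ContDiff ℝ 2 fun y : Euc m => ‖y - p‖ ^ 2 :=
    (contDiff_id.sub contDiff_const).norm_sq ℝ
  have hq : ∀ y : Euc m, HasFDerivAt (fun y : Euc m => ‖y - p‖ ^ 2)
      (2 • innerSL ℝ (y - p)) y := fun y => by
    simpa using ((hasFDerivAt_id y).sub_const p).norm_sq
  rw [laplacian_eq_sum_fderiv (f := fun y : Euc m => g (‖y - p‖ ^ 2)) (hg.comp hn).contDiffAt]
  have e1 : ∀ i : Fin m, (fun y : Euc m => fderiv ℝ (fun y => g (‖y - p‖ ^ 2)) y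
      (EuclideanSpace.single i 1)) = fun y => g₁ (‖y - p‖ ^ 2) * (2 * (y i - p i)) := by
    intro i
    ext y
    have := ((h₁ (‖y - p‖ ^ 2)).comp_hasFDerivAt y (hq y)).fderiv
    simp only [Function.comp_def] at this
    rw [this]
    simp [EuclideanSpace.inner_single_right]
  have e2 : ∀ i : Fin m, fderiv ℝ (fun y : Euc m => g₁ (‖y - p‖ ^ 2) * (2 * (y i - p i))) x
      (EuclideanSpace.single i 1) =
      4 * g₂ (‖x - p‖ ^ 2) * (x i - p i) ^ 2 + 2 * g₁ (‖x - p‖ ^ 2) := by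
    intro i
    have a := (h₂ (‖x - p‖ ^ 2)).comp_hasFDerivAt x (hq x)
    have b : HasFDerivAt (fun y : Euc m => 2 * (y i - p i))
        ((2 : ℝ) • (EuclideanSpace.proj i : Euc m →L[ℝ] ℝ)) x :=
      (((EuclideanSpace.proj i : Euc m →L[ℝ] ℝ).hasFDerivAt).sub_const (p i)).const_mul 2
    have := (a.mul b).fderiv
    simp only [Function.comp_def] at this
    erw [this]
    simp [EuclideanSpace.inner_single_right]
    ring
  simp only [e1, e2, Finset.sum_add_distrib, ← Finset.mul_sum]
  rw [EuclideanSpace.norm_sq_eq (x - p)]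
  simp
  ring

end Laplacian

/-! ### Powers of the positive part, and differentiation under the integral sign. -/

lemma HasDerivAt.max_zero_pow {n : ℕ} (hn : n ≠ 0) (r : ℝ) :
    HasDerivAt (fun s : ℝ => max s 0 ^ (n + 1)) ((n + 1) * max r 0 ^ n) r := by
  rcases lt_trichotomy r 0 with h | h | h
  · rw [max_eq_right h.le, zero_pow hn, mul_zero]
    refine (hasDerivAt_const r (0 : ℝ)).congr_of_eventuallyEq ?_
    filter_upwards [gt_mem_nhds h] with s hs
    simp [max_eq_right (le_of_lt hs)]
  · subst h
    rw [max_self, zero_pow hn, mul_zero]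
    -- Written as `s * max s 0 ^ n`, the function has difference quotient `max s 0 ^ n` at `0`,
    -- which tends to `0` because `n ≠ 0`.
    have : HasDerivAt (fun s : ℝ => s * max s 0 ^ n) (0 : ℝ) 0 := by
      rw [hasDerivAt_iff_tendsto_slope]
      have h : Filter.Tendsto (fun s : ℝ => max s 0 ^ n) (nhds 0) (nhds 0) := by
        have : Continuous fun s : ℝ => max s 0 ^ n := by fun_prop
        simpa [hn] using this.tendsto 0
      refine (h.mono_left nhdsWithin_le_nhds).congr' ?_
      filter_upwards [self_mem_nhdsWithin] with s hs
      have hs' : s ≠ 0 := hs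
      simp [slope_def_field, hs']
    refine this.congr_of_eventuallyEq (Filter.Eventually.of_forall fun s => ?_)
    rcases le_total s 0 with hs | hs
    · simp [hs, hn]
    · simp only [max_eq_left hs]; ring
  · rw [max_eq_left h.le]
    have := hasDerivAt_pow (n + 1) r
    simp only [Nat.cast_add, Nat.cast_one, Nat.add_sub_cancel] at this
    refine this.congr_of_eventuallyEq ?_
    filter_upwards [lt_mem_nhds h] with s hs
    rw [max_eq_left (le_of_lt hs)]

/-- The cube is the lowest power of the positive part that is `C²`, the regularity which Green's
identity requires of a test function. -/
lemma contDiff_max_zero_pow_three : ContDiff ℝ 2 fun s : ℝ => max s 0 ^ 3 := by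
  have h1 : deriv (fun s : ℝ => max s 0 ^ 3) = fun s => 3 * max s 0 ^ 2 := by
    ext s
    rw [(HasDerivAt.max_zero_pow two_ne_zero s).deriv]; norm_num
  have h2 : deriv (fun s : ℝ => max s 0 ^ 2) = fun s => 2 * max s 0 := by
    ext s
    rw [(HasDerivAt.max_zero_pow one_ne_zero s).deriv]; norm_num
  have c1 : ContDiff ℝ 1 fun s : ℝ => max s 0 ^ 2 := by
    rw [show (1 : WithTop ℕ∞) = 0 + 1 by norm_num, contDiff_succ_iff_deriv]
    refine ⟨fun s => (HasDerivAt.max_zero_pow one_ne_zero s).differentiableAt, by simp, ?_⟩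
    rw [h2, contDiff_zero]; fun_prop
  rw [show (2 : WithTop ℕ∞) = 1 + 1 by norm_num, contDiff_succ_iff_deriv]
  refine ⟨fun s => (HasDerivAt.max_zero_pow two_ne_zero s).differentiableAt, by simp, ?_⟩
  rw [h1]
  exact contDiff_const.mul c1

/-- Differentiation under the integral sign, for an integrand supported in a fixed compact set. -/
lemma hasDerivAt_integral_of_contDiffOn {m : ℕ} {F : ℝ → Euc m → ℝ} {a b : ℝ} {K : Set (Euc m)}
    (hK : IsCompact K) (hF : ContDiffOn ℝ 1 (fun z : ℝ × Euc m => F z.1 z.2) (Ioo a b ×ˢ univ))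
    (h0 : ∀ t ∈ Ioo a b, ∀ y ∉ K, F t y = 0) {t : ℝ} (ht : t ∈ Ioo a b) :
    HasDerivAt (fun s => ∫ y, F s y) (∫ y, deriv (fun s => F s y) t) t := by
  have hU : IsOpen (Ioo a b ×ˢ (univ : Set (Euc m))) := isOpen_Ioo.prod isOpen_univ
  set G : ℝ × Euc m → ℝ := fun z => F z.1 z.2 with hG
  set D : ℝ × Euc m → ℝ := fun z => fderiv ℝ G z (1, 0) with hD
  have hDc : ContinuousOn D (Ioo a b ×ˢ univ) :=
    (hF.continuousOn_fderiv_of_isOpen hU le_rfl).clm_apply continuousOn_const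
  have hder : ∀ s ∈ Ioo a b, ∀ y, HasDerivAt (fun s => F s y) (D (s, y)) s := by
    intro s hs y
    have h1 : HasFDerivAt G (fderiv ℝ G (s, y)) (s, y) :=
      ((hF.contDiffAt (hU.mem_nhds ⟨hs, mem_univ _⟩)).differentiableAt (by norm_num)).hasFDerivAt
    exact h1.comp_hasDerivAt s ((hasDerivAt_id s).prodMk (hasDerivAt_const s y))
  -- A closed ball inside the time interval, times `K`, is compact. It gives a uniform bound on the
  -- time derivative, which vanishes off `K`.
  obtain ⟨δ, hδ, hball⟩ := Metric.isOpen_iff.1 isOpen_Ioo t ht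
  have hcb : Metric.closedBall t (δ / 2) ⊆ Ioo a b :=
    (Metric.closedBall_subset_ball (by linarith)).trans hball
  obtain ⟨C, hC⟩ := ((isCompact_closedBall t (δ / 2)).prod hK).exists_bound_of_continuousOn
    (hDc.mono (prod_mono hcb (subset_univ K)))
  have hslice : ∀ {H : ℝ × Euc m → ℝ}, ContinuousOn H (Ioo a b ×ˢ univ) → ∀ s ∈ Ioo a b,
      Continuous fun y => H (s, y) := fun hH s hs =>
    hH.comp_continuous (by fun_prop) fun y => ⟨hs, mem_univ _⟩
  have hD0 : ∀ s ∈ Ioo a b, ∀ y ∉ K, D (s, y) = 0 := by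
    intro s hs y hy
    have : (fun s => F s y) =ᶠ[nhds s] fun _ => 0 := by
      filter_upwards [isOpen_Ioo.mem_nhds hs] with r hr using h0 r hr y hy
    exact (hder s hs y).unique ((hasDerivAt_const s (0 : ℝ)).congr_of_eventuallyEq this)
  have key := hasDerivAt_integral_of_dominated_loc_of_deriv_le (μ := (volume : Measure (Euc m)))
    (F := F) (F' := fun s y => D (s, y)) (x₀ := t) (s := Metric.closedBall t (δ / 2))
    (bound := K.indicator fun _ => C) (Metric.closedBall_mem_nhds t (by linarith))
    (by
      filter_upwards [isOpen_Ioo.mem_nhds ht] with s hs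
      exact (hslice hF.continuousOn s hs).aestronglyMeasurable)
    ((hslice hF.continuousOn t ht).integrable_of_hasCompactSupport
      (HasCompactSupport.intro hK fun y hy => h0 t ht y hy))
    (hslice hDc t ht).aestronglyMeasurable
    (Filter.Eventually.of_forall fun y s hs => by
      by_cases hy : y ∈ K
      · simpa [hy] using hC (s, y) ⟨hs, hy⟩
      · simp [hy, hD0 s (hcb hs) y hy])
    ((integrable_indicator_iff hK.measurableSet).2 (integrableOn_const hK.measure_ne_top))
    (Filter.Eventually.of_forall fun y s hs => hder s (hcb hs) y)
  exact key.2.congr_deriv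
    (integral_congr_ae (Filter.Eventually.of_forall fun y => (hder t ht y).deriv.symm))

/-! ### The heat kernel: heat equation, mass, approximation of the identity. -/

section HeatKernel

variable {m : ℕ}

lemma heatKernel_pos (p x : Euc m) {s : ℝ} (hs : 0 < s) : 0 < heatKernel p s x := by
  unfold heatKernel; positivity

lemma heatKernel_comm (p x : Euc m) (s : ℝ) : heatKernel p s x = heatKernel x s p := by
  unfold heatKernel; rw [norm_sub_rev]

lemma heatKernel_le (p x : Euc m) {s : ℝ} (hs : 0 < s) :
    heatKernel p s x ≤ ((4 * Real.pi * s) ^ ((m : ℝ) / 2))⁻¹ := by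
  unfold heatKernel
  rw [div_eq_mul_inv]
  refine mul_le_of_le_one_left (by positivity) (Real.exp_le_one_iff.2 ?_)
  have : 0 ≤ ‖x - p‖ ^ 2 / (4 * s) := by positivity
  linarith

lemma hasDerivAt_heatKernel_time (p x : Euc m) {s : ℝ} (hs : 0 < s) :
    HasDerivAt (fun s => heatKernel p s x)
      (heatKernel p s x * (‖x - p‖ ^ 2 / (4 * s ^ 2) - m / (2 * s))) s := by
  have hpi := Real.pi_pos
  have hb : (4 * Real.pi * s) ≠ 0 := by positivity
  have h1 : HasDerivAt (fun s : ℝ => (4 * Real.pi * s) ^ ((m : ℝ) / 2))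
      (4 * Real.pi * ((m : ℝ) / 2) * (4 * Real.pi * s) ^ ((m : ℝ) / 2 - 1)) s := by
    have := (((hasDerivAt_id s).const_mul (4 * Real.pi)).rpow_const (p := (m : ℝ) / 2) (Or.inl hb))
    simpa using this
  have h2 : HasDerivAt (fun s : ℝ => -(‖x - p‖ ^ 2 / (4 * s))) (‖x - p‖ ^ 2 / (4 * s ^ 2)) s := by
    have := ((hasDerivAt_inv hs.ne').const_mul (-(‖x - p‖ ^ 2 / 4)))
    refine (this.congr_deriv (by field_simp)).congr_of_eventuallyEq ?_
    refine Filter.Eventually.of_forall fun r => ?_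
    simp only [div_eq_mul_inv, mul_inv]; ring
  have h3 := h2.exp.div h1 (by positivity)
  refine h3.congr_deriv ?_
  rw [Real.rpow_sub_one hb]
  unfold heatKernel
  have : (4 * Real.pi * s) ^ ((m : ℝ) / 2) ≠ 0 := by positivity
  field_simp

lemma contDiffOn_heatKernel (p : Euc m) : ContDiffOn ℝ ∞
    (fun z : ℝ × Euc m => heatKernel p z.1 z.2) (Ioi 0 ×ˢ univ) := by
  rintro ⟨s, x⟩ ⟨hs, -⟩
  have hs : (0 : ℝ) < s := hs
  have hpi := Real.pi_pos
  refine ContDiffAt.contDiffWithinAt ?_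
  unfold heatKernel
  have hn : ContDiff ℝ ∞ fun z : ℝ × Euc m => ‖z.2 - p‖ ^ 2 :=
    (contDiff_snd.sub contDiff_const).norm_sq ℝ
  refine ContDiffAt.div ?_ ?_ (by positivity)
  · exact (hn.contDiffAt.div (contDiff_const.mul contDiff_fst).contDiffAt
      (by positivity : (4 * s) ≠ 0)).neg.exp
  · exact (contDiff_const.mul contDiff_fst).contDiffAt.rpow_const_of_ne
      (by positivity : (4 * Real.pi * s) ≠ 0)

lemma contDiff_heatKernel (p : Euc m) {s : ℝ} (hs : 0 < s) : ContDiff ℝ ∞ (heatKernel p s) := by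
  rw [← contDiffOn_univ]
  exact (contDiffOn_heatKernel p).comp (f := fun x : Euc m => (s, x)) (by fun_prop)
    fun x _ => ⟨hs, mem_univ _⟩

/-- Differentiation keeps the Gaussian factor and replaces `g` by `g' - b * g`, so the lemma can be
iterated for the second derivative. -/
lemma hasDerivAt_gaussianProfile {g : ℝ → ℝ} {g' a b r : ℝ} (hg : HasDerivAt g g' r) :
    HasDerivAt (fun r => a * Real.exp (-(b * r)) * g r)
      (a * Real.exp (-(b * r)) * (g' - b * g r)) r := by
  have h := (((hasDerivAt_id r).const_mul b).neg.exp.const_mul a).mul hg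
  refine h.congr_deriv ?_
  simp
  ring

lemma heatKernel_eq (p x : Euc m) (s : ℝ) : heatKernel p s x =
    ((4 * Real.pi * s) ^ ((m : ℝ) / 2))⁻¹ * Real.exp (-((4 * s)⁻¹ * ‖x - p‖ ^ 2)) := by
  unfold heatKernel
  rw [div_eq_inv_mul (Real.exp _), div_eq_inv_mul (‖x - p‖ ^ 2)]

/-- The Laplacian of the product of the heat kernel with a function of the squared distance to its
center. -/
lemma laplacian_heatKernel_mul {g g₁ g₂ : ℝ → ℝ} (hg : ContDiff ℝ 2 g)
    (h₁ : ∀ r, HasDerivAt g (g₁ r) r) (h₂ : ∀ r, HasDerivAt g₁ (g₂ r) r) (p x : Euc m) {s : ℝ}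
    (hs : 0 < s) :
    (Δ fun y => heatKernel p s y * g (‖y - p‖ ^ 2)) x = heatKernel p s x *
      ((‖x - p‖ ^ 2 / (4 * s ^ 2) - m / (2 * s)) * g (‖x - p‖ ^ 2) +
        4 * ‖x - p‖ ^ 2 * g₂ (‖x - p‖ ^ 2) - 2 * ‖x - p‖ ^ 2 / s * g₁ (‖x - p‖ ^ 2) +
        2 * m * g₁ (‖x - p‖ ^ 2)) := by
  have hc : ContDiff ℝ 2 fun r => ((4 * Real.pi * s) ^ ((m : ℝ) / 2))⁻¹ *
      Real.exp (-((4 * s)⁻¹ * r)) * g r :=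
    (contDiff_const.mul (contDiff_const.mul contDiff_id).neg.exp).mul hg
  simp only [heatKernel_eq]
  rw [laplacian_comp_norm_sub_sq hc (fun r => hasDerivAt_gaussianProfile (h₁ r))
    (fun r => hasDerivAt_gaussianProfile ((h₂ r).sub ((h₁ r).const_mul _))) p x]
  field_simp
  ring

/-- The right-hand side is the time derivative in `hasDerivAt_heatKernel_time`: the kernel solves
the forward heat equation. -/
lemma laplacian_heatKernel (p x : Euc m) {s : ℝ} (hs : 0 < s) :
    (Δ (heatKernel p s)) x =
      heatKernel p s x * (‖x - p‖ ^ 2 / (4 * s ^ 2) - m / (2 * s)) := by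
  have := laplacian_heatKernel_mul (g := fun _ => 1) (g₁ := fun _ => 0) (g₂ := fun _ => 0)
    contDiff_const (fun r => hasDerivAt_const _ _) (fun r => hasDerivAt_const _ _) p x hs
  simpa using this

lemma integral_heatKernel (p : Euc m) {s : ℝ} (hs : 0 < s) : ∫ x, heatKernel p s x = 1 := by
  have hpi := Real.pi_pos
  simp only [heatKernel_eq, integral_const_mul]
  rw [integral_sub_right_eq_self (fun x : Euc m => Real.exp (-((4 * s)⁻¹ * ‖x‖ ^ 2))) p]
  have := GaussianFourier.integral_rexp_neg_mul_sq_norm (V := Euc m)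
    (b := (4 * s)⁻¹) (by positivity)
  simp only [neg_mul] at this
  rw [this, finrank_euclideanSpace_fin, show Real.pi / (4 * s)⁻¹ = 4 * Real.pi * s by
    field_simp]
  exact inv_mul_cancel₀ (by positivity)

lemma integrable_heatKernel (p : Euc m) {s : ℝ} (hs : 0 < s) : Integrable (heatKernel p s) := by
  -- The integral of a nonintegrable function is `0` by convention, whereas this one is `1`.
  by_contra h
  have := integral_heatKernel p hs
  rw [integral_undef h] at this
  exact zero_ne_one this

/-- The heat kernel at time `τ` belongs to `𝓕_τ`. -/
lemma heatKernel_mem_admissibleFamily (p : Euc m) {τ : ℝ} (hτ : 0 < τ) :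
    heatKernel p τ ∈ admissibleFamily m τ := by
  refine ⟨contDiff_heatKernel p hτ, fun x => heatKernel_pos p x hτ, integrable_heatKernel p hτ,
    integral_heatKernel p hτ, fun t x => heatKernel p (τ - t) x, ⟨?_, ?_, ?_⟩, by simp⟩
  · exact (contDiffOn_heatKernel p).comp (f := fun z : ℝ × Euc m => (τ - z.1, z.2))
      (by fun_prop) fun z hz => ⟨sub_pos.2 hz.1.2, mem_univ _⟩
  · exact fun t ht x => heatKernel_pos p x (sub_pos.2 ht.2)
  · intro t ht x
    have h := (hasDerivAt_heatKernel_time p x (sub_pos.2 ht.2)).scomp t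
      ((hasDerivAt_id t).const_sub τ)
    refine (h.congr_deriv ?_).hasDerivWithinAt
    rw [show (fun x => heatKernel p (τ - t) x) = heatKernel p (τ - t) from rfl,
      laplacian_heatKernel p x (sub_pos.2 ht.2)]
    simp

/-- Convolution with the heat kernel converges to the identity as time tends to zero. -/
lemma tendsto_integral_mul_heatKernel {u : Euc m → ℝ} (hu : Integrable u) (hc : Continuous u)
    (x : Euc m) :
    Filter.Tendsto (fun s => ∫ y, u y * heatKernel x s y) (nhdsWithin 0 (Ioi 0)) (nhds (u x)) := by
  have h := Real.tendsto_integral_gaussian_smul' (V := Euc m) (E := ℂ) (f := fun y => (u y : ℂ))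
    hu.ofReal (v := x) (by fun_prop)
  -- The Gaussian in `h` is `(π c) ^ (m / 2) * exp (-π² c ‖x - y‖²)` with `c → ∞`; taking `c = 1 /
  -- (4 π² s)` makes it the heat kernel at time `s`.
  have h2 : Filter.Tendsto (fun s : ℝ => (4 * Real.pi ^ 2)⁻¹ * s⁻¹) (nhdsWithin 0 (Ioi 0))
      Filter.atTop :=
    tendsto_inv_nhdsGT_zero.const_mul_atTop (by positivity)
  have h3 := Complex.continuous_re.continuousAt.tendsto.comp (h.comp h2)
  simp only [Complex.ofReal_re, Function.comp_def] at h3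
  refine h3.congr' ?_
  filter_upwards [self_mem_nhdsWithin] with s hs
  have hs : (0 : ℝ) < s := hs
  rw [← Complex.ofReal_re (∫ y, u y * heatKernel x s y), ← integral_complex_ofReal]
  congr 1
  refine integral_congr_ae (Filter.Eventually.of_forall fun y => ?_)
  have hpi := Real.pi_pos
  have e1 : (Real.pi : ℂ) * (((4 * Real.pi ^ 2)⁻¹ * s⁻¹ : ℝ) : ℂ) =
      (((4 * Real.pi * s)⁻¹ : ℝ) : ℂ) := by
    push_cast; field_simp
  have e2 : -(Real.pi : ℂ) ^ 2 * (((4 * Real.pi ^ 2)⁻¹ * s⁻¹ : ℝ) : ℂ) * (‖x - y‖ : ℂ) ^ 2 =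
      ((-((4 * s)⁻¹ * ‖y - x‖ ^ 2) : ℝ) : ℂ) := by
    rw [norm_sub_rev x y]; push_cast; field_simp
  have e3 : ((Module.finrank ℝ (Euc m) : ℂ) / 2) = (((m : ℝ) / 2 : ℝ) : ℂ) := by
    rw [finrank_euclideanSpace_fin]; push_cast; rfl
  simp only [e1, e2, e3]
  rw [← Complex.ofReal_cpow (by positivity), heatKernel_eq, ← Complex.ofReal_exp,
    Real.inv_rpow (by positivity)]
  simp [mul_comm]

end HeatKernel

/-! ### Radial cutoffs. -/

section Cutoff

/-- A truncated cubic profile, equal to `1` at `0` and supported in `(-∞, 1 / k]`. -/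
noncomputable def cutoff (k r : ℝ) : ℝ := max (1 - k * r) 0 ^ 3

lemma cutoff_nonneg (k r : ℝ) : 0 ≤ cutoff k r := by unfold cutoff; positivity

lemma cutoff_le_one {k r : ℝ} (hk : 0 ≤ k) (hr : 0 ≤ r) : cutoff k r ≤ 1 := by
  unfold cutoff
  exact pow_le_one₀ (le_max_right _ _) (max_le (by nlinarith [mul_nonneg hk hr]) zero_le_one)

lemma contDiff_cutoff (k : ℝ) : ContDiff ℝ 2 (cutoff k) :=
  contDiff_max_zero_pow_three.comp (contDiff_const.sub (contDiff_const.mul contDiff_id))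

lemma hasDerivAt_cutoff (k r : ℝ) :
    HasDerivAt (cutoff k) (-(3 * k) * max (1 - k * r) 0 ^ 2) r := by
  have h := (HasDerivAt.max_zero_pow two_ne_zero (1 - k * r)).scomp r
    (((hasDerivAt_id r).const_mul k).const_sub 1)
  refine h.congr_deriv ?_
  simp; ring

lemma hasDerivAt_cutoff_deriv (k r : ℝ) :
    HasDerivAt (fun r => -(3 * k) * max (1 - k * r) 0 ^ 2) (6 * k ^ 2 * max (1 - k * r) 0) r := by
  have h := ((HasDerivAt.max_zero_pow one_ne_zero (1 - k * r)).scomp r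
    (((hasDerivAt_id r).const_mul k).const_sub 1)).const_mul (-(3 * k))
  refine h.congr_deriv ?_
  simp; ring

lemma tendsto_cutoff (r : ℝ) :
    Filter.Tendsto (fun k => cutoff k r) (nhdsWithin 0 (Ioi 0)) (nhds 1) := by
  have : Continuous fun k => cutoff k r := by unfold cutoff; fun_prop
  simpa [cutoff] using (this.tendsto 0).mono_left nhdsWithin_le_nhds

/-- The exact support radius is `1 / √k`; the larger radius `1 + 1 / k` avoids the square root. -/
lemma cutoff_eq_zero {m : ℕ} {k : ℝ} (hk : 0 < k) {p y : Euc m}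
    (hy : y ∉ Metric.closedBall p (1 + k⁻¹)) : cutoff k (‖y - p‖ ^ 2) = 0 := by
  rw [Metric.mem_closedBall, dist_eq_norm, not_le] at hy
  have hk' : 0 < k⁻¹ := inv_pos.2 hk
  have h1 : k⁻¹ ≤ ‖y - p‖ ^ 2 := by nlinarith
  have h2 : 1 ≤ k * ‖y - p‖ ^ 2 := by
    calc 1 = k * k⁻¹ := (mul_inv_cancel₀ hk.ne').symm
      _ ≤ _ := mul_le_mul_of_nonneg_left h1 hk.le
  unfold cutoff
  rw [max_eq_right (by linarith)]
  norm_num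

end Cutoff

/-! ### Positive backward solutions: mass bound and comparison with the heat kernel. -/

namespace IsPositiveBackwardHeatSolution

variable {m : ℕ} {τ : ℝ} {v : ℝ → Euc m → ℝ}

lemma contDiff_slice (hv : IsPositiveBackwardHeatSolution τ v) {t : ℝ} (ht : t ∈ Ico 0 τ) :
    ContDiff ℝ ∞ (v t) := by
  rw [← contDiffOn_univ]
  exact hv.smooth.comp (f := fun x : Euc m => (t, x)) (by fun_prop) fun x _ => ⟨ht, mem_univ _⟩

/-- The derivative of the integral of a solution against a compactly supported test function. -/
lemma hasDerivAt_integral_mul (hv : IsPositiveBackwardHeatSolution τ v) {ψ : ℝ → Euc m → ℝ}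
    {K : Set (Euc m)} (hK : IsCompact K)
    (hψ : ContDiffOn ℝ 2 (fun z : ℝ × Euc m => ψ z.1 z.2) (Ico 0 τ ×ˢ univ))
    (h0 : ∀ t, ∀ y ∉ K, ψ t y = 0) {t : ℝ} (ht : t ∈ Ioo 0 τ) :
    HasDerivAt (fun s => ∫ y, v s y * ψ s y)
      (∫ y, v t y * (deriv (fun s => ψ s y) t - (Δ (ψ t)) y)) t := by
  have hsub : Ioo 0 τ ×ˢ (univ : Set (Euc m)) ⊆ Ico 0 τ ×ˢ univ :=
    prod_mono Ioo_subset_Ico_self Subset.rfl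
  have hU : IsOpen (Ioo 0 τ ×ˢ (univ : Set (Euc m))) := isOpen_Ioo.prod isOpen_univ
  have ht' : t ∈ Ico 0 τ := Ioo_subset_Ico_self ht
  have hψs : ContDiff ℝ 2 (ψ t) := by
    rw [← contDiffOn_univ]
    exact hψ.comp (f := fun x : Euc m => (t, x)) (by fun_prop) fun x _ => ⟨ht', mem_univ _⟩
  have hvs : ContDiff ℝ 2 (v t) := (hv.contDiff_slice ht').of_le ENat.LEInfty.out
  have hψc : HasCompactSupport (ψ t) := HasCompactSupport.intro hK (h0 t)
  have hv2 : ContDiffOn ℝ 2 (fun z : ℝ × Euc m => v z.1 z.2) (Ico 0 τ ×ˢ univ) :=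
    hv.smooth.of_le ENat.LEInfty.out
  have hd := hasDerivAt_integral_of_contDiffOn (F := fun s y => v s y * ψ s y) hK
    (((hv2.mul hψ).mono hsub).of_le (by norm_num)) (fun s _ y hy => by simp [h0 s y hy]) ht
  have hψd : ∀ y, HasDerivAt (fun s => ψ s y) (fderiv ℝ (fun z : ℝ × Euc m => ψ z.1 z.2)
      (t, y) (1, 0)) t := fun y => by
    have h1 : HasFDerivAt (fun z : ℝ × Euc m => ψ z.1 z.2) _ (t, y) :=
      (((hψ.mono hsub).contDiffAt (hU.mem_nhds ⟨ht, mem_univ _⟩)).differentiableAt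
        (by norm_num)).hasFDerivAt
    exact h1.comp_hasDerivAt t ((hasDerivAt_id t).prodMk (hasDerivAt_const t y))
  have hψt : Continuous fun y => deriv (fun s => ψ s y) t := by
    have h1 : ContinuousOn (fun z => fderiv ℝ (fun z : ℝ × Euc m => ψ z.1 z.2) z (1, 0))
        (Ioo 0 τ ×ˢ (univ : Set (Euc m))) :=
      ((hψ.mono hsub).continuousOn_fderiv_of_isOpen hU (by norm_num)).clm_apply continuousOn_const
    simp only [fun y => (hψd y).deriv]
    exact h1.comp_continuous (f := fun y : Euc m => (t, y)) (by fun_prop)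
      fun y => ⟨ht, mem_univ _⟩
  have hψt0 : ∀ y ∉ K, deriv (fun s => ψ s y) t = 0 := fun y hy => by
    rw [show (fun s => ψ s y) = fun _ => 0 from funext fun s => h0 s y hy, deriv_const]
  have hlap : ∀ {f : Euc m → ℝ}, ContDiff ℝ 2 f → Continuous (Δ f) := by
    intro f hf
    rw [show Δ f = _ from funext fun x => laplacian_eq_sum_fderiv hf.contDiffAt]
    refine continuous_finsetSum _ fun i _ => ?_
    exact (((hf.fderiv_right (m := 1) (by norm_num)).clm_apply
      contDiff_const).continuous_fderiv (by norm_num)).clm_apply continuous_const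
  have hlap0 : ∀ y ∉ K, (Δ (ψ t)) y = 0 := by
    intro y hy
    have : ψ t =ᶠ[nhds y] fun _ => (0 : ℝ) := by
      filter_upwards [hK.isClosed.isOpen_compl.mem_nhds hy] with z hz using h0 t z hz
    rw [InnerProductSpace.laplacian_congr_nhds this |>.self_of_nhds]
    simp
  have i1 : Integrable fun y => (Δ (v t)) y * ψ t y :=
    ((hlap hvs).mul hψs.continuous).integrable_of_hasCompactSupport hψc.mul_left
  have i2 : Integrable fun y => v t y * deriv (fun s => ψ s y) t :=
    (hvs.continuous.mul hψt).integrable_of_hasCompactSupport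
      (HasCompactSupport.intro hK fun y hy => by simp [hψt0 y hy])
  have i3 : Integrable fun y => v t y * (Δ (ψ t)) y :=
    (hvs.continuous.mul (hlap hψs)).integrable_of_hasCompactSupport
      (HasCompactSupport.intro hK fun y hy => by simp [hlap0 y hy])
  refine hd.congr_deriv ?_
  calc ∫ y, deriv (fun s => v s y * ψ s y) t
      = ∫ y, (v t y * deriv (fun s => ψ s y) t - (Δ (v t)) y * ψ t y) := by
        refine integral_congr_ae (Filter.Eventually.of_forall fun y => ?_)
        have h1 : HasDerivAt (fun s => v s y) (-(Δ (v t)) y) t :=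
          (hv.eqn t ht' y).hasDerivAt (Ico_mem_nhds ht.1 ht.2)
        have h2 := (h1.mul (hψd y).differentiableAt.hasDerivAt).deriv
        simp only
        erw [h2]
        ring
    _ = _ := by
        -- Green's identity moves the Laplacian from `v t` to the test function.
        rw [integral_sub i2 i1, integral_laplacian_mul hvs hψs hψc, ← integral_sub i2 i3]
        simp only [mul_sub]

/-- By `hc`, the pairing plus `c * t` has nonnegative derivative for positive times. It is
continuous up to `t = 0`, so it is monotone from there on. -/
lemma integral_mul_zero_le (hv : IsPositiveBackwardHeatSolution τ v) {ψ : ℝ → Euc m → ℝ}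
    {K : Set (Euc m)} (hK : IsCompact K)
    (hψ : ContDiffOn ℝ 2 (fun z : ℝ × Euc m => ψ z.1 z.2) (Ico 0 τ ×ˢ univ))
    (h0 : ∀ t, ∀ y ∉ K, ψ t y = 0) {c : ℝ}
    (hc : ∀ t ∈ Ioo 0 τ, -c ≤ ∫ y, v t y * (deriv (fun s => ψ s y) t - (Δ (ψ t)) y))
    {t : ℝ} (ht : t ∈ Ico 0 τ) :
    ∫ y, v 0 y * ψ 0 y ≤ (∫ y, v t y * ψ t y) + c * t := by
  have hcont : ContinuousOn (fun s => ∫ y, v s y * ψ s y) (Ico 0 τ) :=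
    continuousOn_integral_of_compact_support hK (hv.smooth.continuousOn.mul hψ.continuousOn)
      fun s y _ hy => by simp [h0 s y hy]
  have hsub : Icc 0 t ⊆ Ico 0 τ := Icc_subset_Ico_right ht.2
  have hd : ∀ s ∈ Ioo 0 t, HasDerivAt (fun s => (∫ y, v s y * ψ s y) + c * s)
      ((∫ y, v s y * (deriv (fun s => ψ s y) s - (Δ (ψ s)) y)) + c) s := fun s hs => by
    simpa using! (hv.hasDerivAt_integral_mul hK hψ h0 ⟨hs.1, hs.2.trans ht.2⟩).add
      ((hasDerivAt_id s).const_mul c)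
  have hmono : MonotoneOn (fun s => (∫ y, v s y * ψ s y) + c * s) (Icc 0 t) := by
    refine monotoneOn_of_deriv_nonneg (convex_Icc 0 t)
      ((hcont.mono hsub).add (by fun_prop)) ?_ ?_
    · rw [interior_Icc]
      exact fun s hs => (hd s hs).differentiableAt.differentiableWithinAt
    · rw [interior_Icc]
      intro s hs
      rw [(hd s hs).deriv]
      linarith [hc s ⟨hs.1, hs.2.trans ht.2⟩]
  simpa using hmono (left_mem_Icc.2 ht.1) (right_mem_Icc.2 ht.1) ht.1

/-- The cutoff `χ` satisfies `Δχ ≥ -l χ`. Hence `ψ = -exp (-l t) χ` has `ψ_t - Δψ = exp (-l t) (l χ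
+ Δχ) ≥ 0`, and `integral_mul_zero_le` applies with `c = 0`. -/
lemma integral_mul_cutoff_le (hv : IsPositiveBackwardHeatSolution τ v) {k : ℝ} (hk : 0 < k)
    {t : ℝ} (ht : t ∈ Ico 0 τ) :
    Real.exp (-(k * (4 + m) ^ 2 * t)) * ∫ y, v t y * cutoff k (‖y‖ ^ 2) ≤
      ∫ y, v 0 y * cutoff k (‖y‖ ^ 2) := by
  set l : ℝ := k * (4 + m) ^ 2 with hl
  have hχ : ContDiff ℝ 2 fun y : Euc m => cutoff k (‖y‖ ^ 2) :=
    (contDiff_cutoff k).comp (contDiff_id.norm_sq ℝ)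
  have h := hv.integral_mul_zero_le (ψ := fun t y => -Real.exp (-(l * t)) * cutoff k (‖y‖ ^ 2))
    (isCompact_closedBall 0 (1 + k⁻¹)) (c := 0) ?_ ?_ ?_ ht
  · simp only [neg_mul, mul_neg, integral_neg, zero_mul, add_zero, mul_zero, neg_zero,
      Real.exp_zero, one_mul, neg_le_neg_iff] at h
    refine le_trans (le_of_eq ?_) h
    rw [← integral_const_mul]
    congr 1 with y
    ring
  · exact ((contDiff_const.mul contDiff_fst).neg.exp.neg.mul
      (hχ.comp contDiff_snd)).contDiffOn
  · intro t y hy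
    have := cutoff_eq_zero hk hy
    rw [sub_zero] at this
    simp [this]
  · intro s hs
    rw [neg_zero]
    refine integral_nonneg fun y => mul_nonneg (hv.pos s (Ioo_subset_Ico_self hs) y).le ?_
    have h1 : HasDerivAt (fun t => -Real.exp (-(l * t)) * cutoff k (‖y‖ ^ 2))
        (l * Real.exp (-(l * s)) * cutoff k (‖y‖ ^ 2)) s := by
      refine (((hasDerivAt_id s).const_mul l).neg.exp.neg.mul_const _).congr_deriv ?_
      simp [mul_comm l]
    have h2 := laplacian_comp_norm_sub_sq (contDiff_cutoff k) (hasDerivAt_cutoff k)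
      (hasDerivAt_cutoff_deriv k) 0 y
    have h3 : (Δ fun y : Euc m => -Real.exp (-(l * s)) * cutoff k (‖y‖ ^ 2)) y =
        -Real.exp (-(l * s)) * (Δ fun y : Euc m => cutoff k (‖y‖ ^ 2)) y :=
      InnerProductSpace.laplacian_smul (-Real.exp (-(l * s))) hχ.contDiffAt
    simp only [sub_zero] at h2
    rw [h1.deriv, h3, h2]
    set r := ‖y‖ ^ 2
    have key : 0 ≤ l * cutoff k r + (4 * r * (6 * k ^ 2 * max (1 - k * r) 0) +
        2 * m * (-(3 * k) * max (1 - k * r) 0 ^ 2)) := by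
      unfold cutoff
      rcases le_total (1 - k * r) 0 with hM | hM
      · simp [max_eq_right hM]
      · rw [max_eq_left hM]
        set M := 1 - k * r with hMd
        -- The constant `(4 + m) ^ 2` in `l` completes the square: the bracket is `X² - 6 X + 24`
        -- with `X = (4 + m) M`.
        have : l * M ^ 3 + (4 * r * (6 * k ^ 2 * M) + 2 * m * (-(3 * k) * M ^ 2)) =
            k * M * ((((4 + m) * M - 3) ^ 2) + 15) := by
          rw [hl, show 4 * r * (6 * k ^ 2 * M) = 24 * k * M * (k * r) by ring,
            show k * r = 1 - M by rw [hMd]; ring]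
          ring
        rw [this]
        positivity
    calc (0 : ℝ) ≤ Real.exp (-(l * s)) * _ := mul_nonneg (Real.exp_pos _).le key
      _ = _ := by ring

/-- The mass of a solution at any time is at most its mass at time zero. -/
lemma lintegral_le_one (hv : IsPositiveBackwardHeatSolution τ v) (hi : Integrable (v 0))
    (h1 : ∫ y, v 0 y = 1) {t : ℝ} (ht : t ∈ Ico 0 τ) :
    ∫⁻ y, ENNReal.ofReal (v t y) ≤ 1 := by
  have h0 : (0 : ℝ) ∈ Ico 0 τ := ⟨le_rfl, ht.1.trans_lt ht.2⟩
  set κ : ℕ → ℝ := fun j => ((j : ℝ) + 1)⁻¹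
  have hκ : ∀ j, 0 < κ j := fun j => by positivity
  have hκ0 : Filter.Tendsto κ Filter.atTop (nhdsWithin 0 (Ioi 0)) := by
    refine tendsto_nhdsWithin_iff.2 ⟨?_, Filter.Eventually.of_forall hκ⟩
    simpa [κ] using tendsto_one_div_add_atTop_nhds_zero_nat (𝕜 := ℝ)
  -- As `κ j → 0` both the exponential and the cutoff tend to `1`. Integrability of `v t` is not yet
  -- known, so the limit is taken by Fatou.
  set f : ℕ → Euc m → ℝ := fun j y =>
    Real.exp (-(κ j * (4 + m) ^ 2 * t)) * (v t y * cutoff (κ j) (‖y‖ ^ 2)) with hf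
  have hvt := hv.contDiff_slice ht
  have hcut : ∀ j, Continuous fun y : Euc m => cutoff (κ j) (‖y‖ ^ 2) := fun j =>
    (contDiff_cutoff _).continuous.comp (by fun_prop)
  have hfc : ∀ j, Continuous (f j) := fun j =>
    continuous_const.mul (hvt.continuous.mul (hcut j))
  have hf0 : ∀ j y, 0 ≤ f j y := fun j y =>
    mul_nonneg (Real.exp_pos _).le (mul_nonneg (hv.pos t ht y).le (cutoff_nonneg _ _))
  have hfi : ∀ j, Integrable (f j) := fun j => by
    refine (hfc j).integrable_of_hasCompactSupport
      (HasCompactSupport.intro (isCompact_closedBall 0 (1 + (κ j)⁻¹)) fun y hy => ?_)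
    have := cutoff_eq_zero (hκ j) hy
    rw [sub_zero] at this
    simp [hf, this]
  have hle : ∀ j, ∫⁻ y, ENNReal.ofReal (f j y) ≤ 1 := by
    intro j
    rw [← ofReal_integral_eq_lintegral_ofReal (hfi j) (Filter.Eventually.of_forall (hf0 j)),
      ENNReal.ofReal_le_one, integral_const_mul]
    refine (hv.integral_mul_cutoff_le (hκ j) ht).trans (h1 ▸ ?_)
    refine integral_mono_of_nonneg (Filter.Eventually.of_forall fun y =>
      mul_nonneg (hv.pos 0 h0 y).le (cutoff_nonneg _ _)) hi
      (Filter.Eventually.of_forall fun y => ?_)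
    exact mul_le_of_le_one_right (hv.pos 0 h0 y).le (cutoff_le_one (hκ j).le (by positivity))
  have hlim : ∀ y, Filter.Tendsto (fun j => ENNReal.ofReal (f j y)) Filter.atTop
      (nhds (ENNReal.ofReal (v t y))) := by
    intro y
    refine ENNReal.tendsto_ofReal ?_
    have e : Filter.Tendsto (fun k : ℝ => Real.exp (-(k * (4 + m) ^ 2 * t)))
        (nhdsWithin 0 (Ioi 0)) (nhds 1) := by
      have : Continuous fun k : ℝ => Real.exp (-(k * (4 + (m : ℝ)) ^ 2 * t)) := by fun_prop
      simpa using (this.tendsto 0).mono_left nhdsWithin_le_nhds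
    simpa [hf, Function.comp_def] using ((e.mul ((tendsto_cutoff (‖y‖ ^ 2)).const_mul (v t y))).comp hκ0)
  calc ∫⁻ y, ENNReal.ofReal (v t y)
      = ∫⁻ y, Filter.liminf (fun j => ENNReal.ofReal (f j y)) Filter.atTop :=
        lintegral_congr fun y => (hlim y).liminf_eq.symm
    _ ≤ Filter.liminf (fun j => ∫⁻ y, ENNReal.ofReal (f j y)) Filter.atTop :=
        lintegral_liminf_le fun j => (hfc j).measurable.ennreal_ofReal
    _ ≤ 1 := Filter.liminf_le_of_frequently_le' (Filter.Frequently.of_forall hle)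

lemma integrable_slice (hv : IsPositiveBackwardHeatSolution τ v) (hi : Integrable (v 0))
    (h1 : ∫ y, v 0 y = 1) {t : ℝ} (ht : t ∈ Ico 0 τ) : Integrable (v t) := by
  refine ⟨(hv.contDiff_slice ht).continuous.aestronglyMeasurable, ?_⟩
  rw [hasFiniteIntegral_iff_ofReal (Filter.Eventually.of_forall fun y => (hv.pos t ht y).le)]
  exact (hv.lintegral_le_one hi h1 ht).trans_lt ENNReal.one_lt_top

lemma integral_slice_le_one (hv : IsPositiveBackwardHeatSolution τ v) (hi : Integrable (v 0))
    (h1 : ∫ y, v 0 y = 1) {t : ℝ} (ht : t ∈ Ico 0 τ) : ∫ y, v t y ≤ 1 := by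
  rw [integral_eq_lintegral_of_nonneg_ae
    (Filter.Eventually.of_forall fun y => (hv.pos t ht y).le)
    (hv.contDiff_slice ht).continuous.aestronglyMeasurable]
  exact ENNReal.toReal_le_of_le_ofReal zero_le_one
    (by simpa using hv.lintegral_le_one hi h1 ht)

/-- The terms with the undifferentiated cutoff cancel by the heat equation. Of the rest, one is
nonnegative and the other two are each at least `-24 A k`, where `A` bounds the kernel for all times
`s + ε`. -/
lemma heatKernel_mul_cutoff_subsolution {k ε s : ℝ} (hk : 0 < k) (hε : 0 < ε) (hs : 0 < s)
    (p y : Euc m) :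
    -(48 * ((4 * Real.pi * ε) ^ ((m : ℝ) / 2))⁻¹ * k) ≤
      deriv (fun s => heatKernel p (s + ε) y * cutoff k (‖y - p‖ ^ 2)) s -
      (Δ fun y => heatKernel p (s + ε) y * cutoff k (‖y - p‖ ^ 2)) y := by
  have hsε : 0 < s + ε := by linarith
  have hd := ((hasDerivAt_heatKernel_time p y hsε).comp_add_const s ε).mul_const
    (cutoff k (‖y - p‖ ^ 2))
  rw [hd.deriv, laplacian_heatKernel_mul (contDiff_cutoff k) (hasDerivAt_cutoff k)
    (hasDerivAt_cutoff_deriv k) p y hsε]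
  set r := ‖y - p‖ ^ 2 with hr
  have hr0 : 0 ≤ r := by positivity
  set σ := s + ε
  set H := heatKernel p σ y with hH
  have hH0 : 0 < H := heatKernel_pos p y hsε
  set A := ((4 * Real.pi * ε) ^ ((m : ℝ) / 2))⁻¹
  have hpi := Real.pi_pos
  have hA : ((4 * Real.pi * σ) ^ ((m : ℝ) / 2))⁻¹ ≤ A := by
    refine inv_anti₀ (by positivity) (Real.rpow_le_rpow (by positivity) ?_ (by positivity))
    exact mul_le_mul_of_nonneg_left (by simp only [σ]; linarith) (by positivity)
  have hHA : H ≤ A := (heatKernel_le p y hsε).trans hA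
  -- This is `x * exp (-x) ≤ 1` at `x = r / (4 σ)`.
  have hrH : r * H ≤ 4 * σ * A := by
    have h1 : (4 * σ)⁻¹ * r * Real.exp (-((4 * σ)⁻¹ * r)) ≤ 1 := by
      rw [Real.exp_neg, ← div_eq_mul_inv, div_le_one (Real.exp_pos _)]
      linarith [Real.add_one_le_exp ((4 * σ)⁻¹ * r)]
    have h2 : (4 * σ)⁻¹ * (r * H) ≤ A := by
      rw [hH, heatKernel_eq]
      calc _ = ((4 * Real.pi * σ) ^ ((m : ℝ) / 2))⁻¹ *
            ((4 * σ)⁻¹ * r * Real.exp (-((4 * σ)⁻¹ * r))) := by ring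
        _ ≤ A * 1 := mul_le_mul hA h1 (by positivity) (by positivity)
        _ = A := mul_one A
    rwa [inv_mul_le_iff₀ (by positivity)] at h2
  have hrσ : r / σ * H ≤ 4 * A := by
    rw [div_mul_eq_mul_div, div_le_iff₀ hsε]; linarith
  set M := max (1 - k * r) 0 with hM
  have hM0 : 0 ≤ M := le_max_right _ _
  have hM1 : M ≤ 1 := max_le (by nlinarith [mul_nonneg hk.le hr0]) zero_le_one
  have hM2 : k * r * M ≤ 1 := by
    rcases le_total (1 - k * r) 0 with h | h
    · simp [hM, max_eq_right h]
    · have : k * r ≤ 1 := by linarith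
      nlinarith [mul_nonneg hk.le hr0]
  have hMM : M ^ 2 ≤ 1 := pow_le_one₀ hM0 hM1
  have t1 : 24 * k * (k * r * M) * H ≤ 24 * k * A := by
    have := mul_le_mul hM2 hHA hH0.le zero_le_one
    nlinarith
  have t2 : 6 * k * M ^ 2 * (r / σ * H) ≤ 24 * k * A := by
    have := mul_le_mul hMM hrσ (by positivity) zero_le_one
    nlinarith
  have t3 : 0 ≤ 6 * m * k * M ^ 2 * H := by positivity
  have e : H * (r / (4 * σ ^ 2) - m / (2 * σ)) * cutoff k r -
      H * ((r / (4 * σ ^ 2) - m / (2 * σ)) * cutoff k r + 4 * r * (6 * k ^ 2 * M) -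
        2 * r / σ * (-(3 * k) * M ^ 2) + 2 * m * (-(3 * k) * M ^ 2)) =
      -(24 * k * (k * r * M) * H) - 6 * k * M ^ 2 * (r / σ * H) + 6 * m * k * M ^ 2 * H := by
    ring
  rw [e]
  linarith

/-- One half of the representation of a positive solution as the convolution of a later time slice
with the heat kernel. -/
lemma integral_mul_heatKernel_le (hv : IsPositiveBackwardHeatSolution τ v) (hi : Integrable (v 0))
    (h1 : ∫ y, v 0 y = 1) {t ε : ℝ} (ht : t ∈ Ico 0 τ) (hε : 0 < ε) (p : Euc m) :
    ∫ y, v 0 y * heatKernel p ε y ≤ ∫ y, v t y * heatKernel p (t + ε) y := by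
  have h0 : (0 : ℝ) ∈ Ico 0 τ := ⟨le_rfl, ht.1.trans_lt ht.2⟩
  have hpi := Real.pi_pos
  have hint : ∀ s ∈ Ico 0 τ, Integrable fun y => v s y * heatKernel p (s + ε) y := by
    intro s hs
    have hsε : 0 < s + ε := by linarith [hs.1]
    refine (hv.integrable_slice hi h1 hs).mul_bdd
      (c := ((4 * Real.pi * (s + ε)) ^ ((m : ℝ) / 2))⁻¹)
      (contDiff_heatKernel p hsε).continuous.aestronglyMeasurable
      (Filter.Eventually.of_forall fun y => ?_)
    rw [Real.norm_of_nonneg (heatKernel_pos p y hsε).le]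
    exact heatKernel_le p y hsε
  set A := ((4 * Real.pi * ε) ^ ((m : ℝ) / 2))⁻¹ with hA
  have hχ : ∀ k, ContDiff ℝ 2 fun y : Euc m => cutoff k (‖y - p‖ ^ 2) := fun k =>
    (contDiff_cutoff k).comp ((contDiff_id.sub contDiff_const).norm_sq ℝ)
  -- The error `48 * A * k * t` disappears as `k → 0`, because `A` depends on `ε` but not on `k`.
  have hle : ∀ k > 0, ∫ y, v 0 y * heatKernel p ε y * cutoff k (‖y - p‖ ^ 2) ≤
      (∫ y, v t y * heatKernel p (t + ε) y) + 48 * A * k * t := by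
    intro k hk
    have hK : IsCompact (Metric.closedBall p (1 + k⁻¹)) := isCompact_closedBall _ _
    have hψ : ContDiffOn ℝ 2 (fun z : ℝ × Euc m =>
        heatKernel p (z.1 + ε) z.2 * cutoff k (‖z.2 - p‖ ^ 2)) (Ico 0 τ ×ˢ univ) := by
      refine ContDiffOn.mul ?_ ((hχ k).comp contDiff_snd).contDiffOn
      refine ContDiffOn.of_le ?_ ENat.LEInfty.out
      exact (contDiffOn_heatKernel p).comp (f := fun z : ℝ × Euc m => (z.1 + ε, z.2))
        (by fun_prop) fun z hz => ⟨by have := hz.1.1; simp only [mem_Ioi]; linarith, mem_univ _⟩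
    have hz : ∀ s : ℝ, ∀ y ∉ Metric.closedBall p (1 + k⁻¹),
        heatKernel p (s + ε) y * cutoff k (‖y - p‖ ^ 2) = 0 := fun s y hy => by
      rw [cutoff_eq_zero hk hy, mul_zero]
    have hc : ∀ s ∈ Ioo 0 τ, -(48 * A * k) ≤ ∫ y, v s y *
        (deriv (fun s => heatKernel p (s + ε) y * cutoff k (‖y - p‖ ^ 2)) s -
        (Δ fun y => heatKernel p (s + ε) y * cutoff k (‖y - p‖ ^ 2)) y) := by
      intro s hs
      have hs' := Ioo_subset_Ico_self hs
      have hvi := hv.integrable_slice hi h1 hs'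
      have hpt : ∀ y, v s y * -(48 * A * k) ≤ v s y *
          (deriv (fun s => heatKernel p (s + ε) y * cutoff k (‖y - p‖ ^ 2)) s -
          (Δ fun y => heatKernel p (s + ε) y * cutoff k (‖y - p‖ ^ 2)) y) := fun y =>
        mul_le_mul_of_nonneg_left (heatKernel_mul_cutoff_subsolution hk hε hs.1 p y)
          (hv.pos s hs' y).le
      have hmass := hv.integral_slice_le_one hi h1 hs'
      have hA0 : 0 ≤ 48 * A * k := by positivity
      -- In the nonintegrable case the integral is `0` by convention, and the lower bound is
      -- nonpositive anyway.
      by_cases hI : Integrable fun y => v s y *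
          (deriv (fun s => heatKernel p (s + ε) y * cutoff k (‖y - p‖ ^ 2)) s -
          (Δ fun y => heatKernel p (s + ε) y * cutoff k (‖y - p‖ ^ 2)) y)
      · refine le_trans ?_ (integral_mono (hvi.mul_const _) hI hpt)
        rw [integral_mul_const]
        nlinarith
      · rw [integral_undef hI]
        linarith
    have h := hv.integral_mul_zero_le hK hψ hz hc ht
    simp only [zero_add] at h
    calc _ = ∫ y, v 0 y * (heatKernel p ε y * cutoff k (‖y - p‖ ^ 2)) := by
          simp only [mul_assoc]
      _ ≤ _ := h
      _ ≤ _ := by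
          refine add_le_add_left ?_ _
          have hsε : 0 < t + ε := by linarith [ht.1]
          refine integral_mono_of_nonneg (Filter.Eventually.of_forall fun y => ?_) (hint t ht)
            (Filter.Eventually.of_forall fun y => ?_)
          · exact mul_nonneg (hv.pos t ht y).le
              (mul_nonneg (heatKernel_pos p y hsε).le (cutoff_nonneg _ _))
          · exact mul_le_mul_of_nonneg_left (mul_le_of_le_one_right (heatKernel_pos p y hsε).le
              (cutoff_le_one hk.le (by positivity))) (hv.pos t ht y).le
  have hi0 : Integrable fun y => v 0 y * heatKernel p ε y := by simpa using hint 0 h0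
  have hlim : Filter.Tendsto
      (fun k => ∫ y, v 0 y * heatKernel p ε y * cutoff k (‖y - p‖ ^ 2))
      (nhdsWithin 0 (Ioi 0)) (nhds (∫ y, v 0 y * heatKernel p ε y)) := by
    refine tendsto_integral_filter_of_dominated_convergence
      (fun y => ‖v 0 y * heatKernel p ε y‖) ?_ ?_ hi0.norm ?_
    · exact Filter.Eventually.of_forall fun k =>
        hi0.aestronglyMeasurable.mul (hχ k).continuous.aestronglyMeasurable
    · filter_upwards [self_mem_nhdsWithin] with k hk
      refine Filter.Eventually.of_forall fun y => ?_
      rw [norm_mul]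
      refine mul_le_of_le_one_right (norm_nonneg _) ?_
      rw [Real.norm_of_nonneg (cutoff_nonneg _ _)]
      exact cutoff_le_one (le_of_lt hk) (by positivity)
    · refine Filter.Eventually.of_forall fun y => ?_
      simpa using (tendsto_cutoff (‖y - p‖ ^ 2)).const_mul (v 0 y * heatKernel p ε y)
  have hlim2 : Filter.Tendsto (fun k => (∫ y, v t y * heatKernel p (t + ε) y) + 48 * A * k * t)
      (nhdsWithin 0 (Ioi 0)) (nhds (∫ y, v t y * heatKernel p (t + ε) y)) := by
    have : Continuous fun k : ℝ => (∫ y, v t y * heatKernel p (t + ε) y) + 48 * A * k * t := by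
      fun_prop
    simpa using (this.tendsto 0).mono_left nhdsWithin_le_nhds
  exact le_of_tendsto_of_tendsto hlim hlim2 (by
    filter_upwards [self_mem_nhdsWithin] with k hk using hle k hk)

end IsPositiveBackwardHeatSolution

/-! ### The Huisken functional: its maximum, and the bound on the weighted area. -/

section Huisken

lemma tendsto_heatKernel_cocompact {m : ℕ} (p : Euc m) {s : ℝ} (hs : 0 < s) :
    Filter.Tendsto (heatKernel p s) (Filter.cocompact (Euc m)) (nhds 0) := by
  have h1 : Filter.Tendsto (fun x : Euc m => ‖x - p‖) (Filter.cocompact _) Filter.atTop :=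
    (tendsto_norm_cocompact_atTop (E := Euc m)).comp
      (Homeomorph.subRight p).isClosedEmbedding.tendsto_cocompact
  have h2 : Filter.Tendsto (fun x : Euc m => (4 * s)⁻¹ * ‖x - p‖ ^ 2) (Filter.cocompact _)
      Filter.atTop :=
    ((Filter.tendsto_pow_atTop two_ne_zero).comp h1).const_mul_atTop (by positivity)
  have h3 := (Real.tendsto_exp_neg_atTop_nhds_zero.comp h2).const_mul
    (((4 * Real.pi * s) ^ ((m : ℝ) / 2))⁻¹)
  rw [mul_zero] at h3
  exact h3.congr fun x => (heatKernel_eq p x s).symm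

variable {n : ℕ} {M : Type*} [TopologicalSpace M] [ChartedSpace (Euc n) M] [MeasurableSpace M]

lemma huiskenFunctional_eq_weightedArea (φ : M → Euc (n + 1)) {τ : ℝ} (hτ : 0 < τ)
    (p : Euc (n + 1)) : huiskenFunctional φ τ p = weightedArea φ τ (heatKernel p τ) := by
  have hpi := Real.pi_pos
  have hb : 0 < 4 * Real.pi * τ := by positivity
  unfold huiskenFunctional weightedArea
  rw [← integral_const_mul]
  congr 1 with q
  have : (4 * Real.pi * τ) ^ (((n + 1 : ℕ) : ℝ) / 2) =
      (4 * Real.pi * τ) ^ ((n : ℝ) / 2) * √(4 * Real.pi * τ) := by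
    rw [Real.sqrt_eq_rpow, ← Real.rpow_add hb]
    congr 1; push_cast; ring
  unfold heatKernel
  rw [this]
  have h1 : √(4 * Real.pi * τ) ≠ 0 := by positivity
  field_simp

lemma huiskenFunctional_nonneg (φ : M → Euc (n + 1)) {τ : ℝ} (hτ : 0 < τ) (p : Euc (n + 1)) :
    0 ≤ huiskenFunctional φ τ p := by
  have hpi := Real.pi_pos
  exact integral_nonneg fun q => by positivity

variable [BorelSpace M] [IsManifold (𝓡 n) ∞ M] [CompactSpace M]

lemma continuous_huiskenFunctional {φ : M → Euc (n + 1)}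
    (hφ : ContMDiff (𝓡 n) (𝓡 (n + 1)) ∞ φ) {τ : ℝ} (hτ : 0 < τ) :
    Continuous (huiskenFunctional φ τ) := by
  have := isFiniteMeasure_inducedArea hφ
  have hc := hφ.continuous
  rw [show huiskenFunctional φ τ = _ from
    funext fun p => huiskenFunctional_eq_weightedArea φ hτ p]
  unfold weightedArea
  refine continuous_const.mul (continuous_of_dominated
    (bound := fun _ => ((4 * Real.pi * τ) ^ (((n + 1 : ℕ) : ℝ) / 2))⁻¹) (fun p => ?_) (fun p => ?_)
    (integrable_const _) ?_)
  · exact ((contDiff_heatKernel p hτ).continuous.comp hc).aestronglyMeasurable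
  · refine Filter.Eventually.of_forall fun q => ?_
    rw [Real.norm_of_nonneg (heatKernel_pos p _ hτ).le]
    exact heatKernel_le p _ hτ
  · refine Filter.Eventually.of_forall fun q => ?_
    simp only [heatKernel_comm _ (φ q)]
    exact (contDiff_heatKernel (φ q) hτ).continuous

lemma tendsto_huiskenFunctional_cocompact {φ : M → Euc (n + 1)}
    (hφ : ContMDiff (𝓡 n) (𝓡 (n + 1)) ∞ φ) {τ : ℝ} (hτ : 0 < τ) :
    Filter.Tendsto (huiskenFunctional φ τ) (Filter.cocompact _) (nhds 0) := by
  have := isFiniteMeasure_inducedArea hφ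
  have hc := hφ.continuous
  rw [show huiskenFunctional φ τ = _ from
    funext fun p => huiskenFunctional_eq_weightedArea φ hτ p]
  unfold weightedArea
  -- Dominated convergence is applied along this filter and needs it countably generated.
  have : (Filter.cocompact (Euc (n + 1))).IsCountablyGenerated := by
    rw [← Metric.cobounded_eq_cocompact, ← comap_norm_atTop]
    infer_instance
  have h : Filter.Tendsto (fun p => ∫ q, heatKernel p τ (φ q) ∂(inducedArea (n := n) φ))
      (Filter.cocompact _) (nhds (∫ _, (0 : ℝ) ∂(inducedArea (n := n) φ))) := by
    refine tendsto_integral_filter_of_dominated_convergence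
      (fun _ => ((4 * Real.pi * τ) ^ (((n + 1 : ℕ) : ℝ) / 2))⁻¹)
      (Filter.Eventually.of_forall fun p => ?_) (Filter.Eventually.of_forall fun p => ?_)
      (integrable_const _) (Filter.Eventually.of_forall fun q => ?_)
    · exact ((contDiff_heatKernel p hτ).continuous.comp hc).aestronglyMeasurable
    · refine Filter.Eventually.of_forall fun q => ?_
      rw [Real.norm_of_nonneg (heatKernel_pos p _ hτ).le]
      exact heatKernel_le p _ hτ
    · simp only [heatKernel_comm _ (φ q)]
      exact tendsto_heatKernel_cocompact (φ q) hτ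
  simpa using h.const_mul (√(4 * Real.pi * τ))

/-- The Huisken functional attains its maximum over the centers. -/
lemma exists_forall_huiskenFunctional_le {φ : M → Euc (n + 1)}
    (hφ : ContMDiff (𝓡 n) (𝓡 (n + 1)) ∞ φ) {τ : ℝ} (hτ : 0 < τ) :
    ∃ p, ∀ q, huiskenFunctional φ τ q ≤ huiskenFunctional φ τ p := by
  by_cases h : ∃ p, 0 < huiskenFunctional φ τ p
  · obtain ⟨p, hp⟩ := h
    refine (continuous_huiskenFunctional hφ hτ).exists_forall_ge' p ?_
    filter_upwards [(tendsto_huiskenFunctional_cocompact hφ hτ).eventually_lt_const hp] with q hq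
      using hq.le
  · push Not at h
    -- With no positive value the functional is identically zero, as when `M` is empty, and any
    -- center is a maximum.
    exact ⟨0, fun q => (h q).trans (huiskenFunctional_nonneg φ hτ 0)⟩

lemma integrable_comp_of_continuous {φ : M → Euc (n + 1)}
    (hφ : ContMDiff (𝓡 n) (𝓡 (n + 1)) ∞ φ) {u : Euc (n + 1) → ℝ} (hu : Continuous u) :
    Integrable (fun q => u (φ q)) (inducedArea (n := n) φ) := by
  have := isFiniteMeasure_inducedArea hφ
  exact (hu.comp hφ.continuous).integrable_of_hasCompactSupport
    (HasCompactSupport.of_compactSpace _)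

lemma lintegral_heatKernel_comp_le {φ : M → Euc (n + 1)}
    (hφ : ContMDiff (𝓡 n) (𝓡 (n + 1)) ∞ φ) {τ S : ℝ} (hτ : 0 < τ)
    (hS : ∀ p, huiskenFunctional φ τ p ≤ S) (p : Euc (n + 1)) :
    ∫⁻ q, ENNReal.ofReal (heatKernel p τ (φ q)) ∂(inducedArea (n := n) φ) ≤
      ENNReal.ofReal (S / √(4 * Real.pi * τ)) := by
  have hpi := Real.pi_pos
  rw [← ofReal_integral_eq_lintegral_ofReal
    (integrable_comp_of_continuous hφ (contDiff_heatKernel p hτ).continuous)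
    (Filter.Eventually.of_forall fun q => (heatKernel_pos p _ hτ).le)]
  refine ENNReal.ofReal_le_ofReal ?_
  rw [le_div_iff₀ (by positivity), mul_comm]
  have := hS p
  rwa [huiskenFunctional_eq_weightedArea φ hτ] at this

/-- The area of a hypersurface weighted by a function in `𝓕_τ` is bounded by the maximum of the
Huisken functional. -/
lemma weightedArea_le {φ : M → Euc (n + 1)} (hφ : ContMDiff (𝓡 n) (𝓡 (n + 1)) ∞ φ)
    {τ S : ℝ} (hτ : 0 < τ) (hS : ∀ p, huiskenFunctional φ τ p ≤ S) {u : Euc (n + 1) → ℝ}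
    (hu : u ∈ admissibleFamily (n + 1) τ) : weightedArea φ τ u ≤ S := by
  obtain ⟨hsm, hpos, hint, hone, v, hv, hv0⟩ := hu
  obtain rfl : v 0 = u := funext hv0
  have hpi := Real.pi_pos
  have := isFiniteMeasure_inducedArea hφ
  have : SecondCountableTopology M := ChartedSpace.secondCountable_of_sigmaCompact (Euc n) M
  set μ := inducedArea (n := n) φ
  have hc := hφ.continuous
  have hS0 : 0 ≤ S := (huiskenFunctional_nonneg φ hτ 0).trans (hS 0)
  set ε : ℕ → ℝ := fun j => τ * ((j : ℝ) + 2)⁻¹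
  have hε : ∀ j, 0 < ε j := fun j => by positivity
  have hετ : ∀ j, ε j ≤ τ := fun j =>
    mul_le_of_le_one_right hτ.le (inv_le_one_of_one_le₀ (by linarith [(j.cast_nonneg : (0:ℝ) ≤ j)]))
  have hε0 : Filter.Tendsto ε Filter.atTop (nhdsWithin 0 (Ioi 0)) := by
    refine tendsto_nhdsWithin_iff.2 ⟨?_, Filter.Eventually.of_forall hε⟩
    have : Filter.Tendsto (fun j : ℕ => ((j : ℝ) + 2)⁻¹) Filter.atTop (nhds 0) :=
      tendsto_inv_atTop_zero.comp
        (Filter.tendsto_atTop_add_const_right _ 2 tendsto_natCast_atTop_atTop)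
    simpa [ε] using this.const_mul τ
  set f : ℕ → M → ℝ := fun j q => ∫ y, v 0 y * heatKernel (φ q) (ε j) y with hf
  have hfm : ∀ j, Measurable fun q => ENNReal.ofReal (f j q) := by
    intro j
    refine Measurable.ennreal_ofReal (Continuous.measurable ?_)
    refine continuous_of_dominated
      (bound := fun y => v 0 y * ((4 * Real.pi * ε j) ^ (((n + 1 : ℕ) : ℝ) / 2))⁻¹)
      (fun q => ?_) (fun q => ?_) (hint.mul_const _) ?_
    · exact (hsm.continuous.mul
        (contDiff_heatKernel (φ q) (hε j)).continuous).aestronglyMeasurable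
    · refine Filter.Eventually.of_forall fun y => ?_
      rw [Real.norm_of_nonneg (mul_nonneg (hpos y).le (heatKernel_pos _ y (hε j)).le)]
      exact mul_le_mul_of_nonneg_left (heatKernel_le _ y (hε j)) (hpos y).le
    · refine Filter.Eventually.of_forall fun y => continuous_const.mul ?_
      simp only [heatKernel_comm _ y]
      exact (contDiff_heatKernel y (hε j)).continuous.comp hc
  have hbound : ∀ j, ∫⁻ q, ENNReal.ofReal (f j q) ∂μ ≤ ENNReal.ofReal (S / √(4 * Real.pi * τ)) := by
    intro j
    -- At time `τ - ε j` the comparison yields kernels of time `(τ - ε j) + ε j = τ`, the scale at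
    -- which `hS` applies.
    have ht : τ - ε j ∈ Ico 0 τ := ⟨sub_nonneg.2 (hετ j), sub_lt_self _ (hε j)⟩
    have hvc := (hv.contDiff_slice ht).continuous
    have hpw : ∀ q, ENNReal.ofReal (f j q) ≤
        ∫⁻ y, ENNReal.ofReal (v (τ - ε j) y) * ENNReal.ofReal (heatKernel y τ (φ q)) := by
      intro q
      refine (ENNReal.ofReal_le_ofReal
        (hv.integral_mul_heatKernel_le hint hone ht (hε j) (φ q))).trans ?_
      rw [sub_add_cancel, integral_eq_lintegral_of_nonneg_ae
        (Filter.Eventually.of_forall fun y =>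
          mul_nonneg (hv.pos _ ht y).le (heatKernel_pos _ y hτ).le)
        (hvc.mul (contDiff_heatKernel (φ q) hτ).continuous).aestronglyMeasurable]
      refine ENNReal.ofReal_toReal_le.trans (le_of_eq (lintegral_congr fun y => ?_))
      rw [ENNReal.ofReal_mul (hv.pos _ ht y).le, heatKernel_comm y]
    have hjoint : Measurable fun z : M × Euc (n + 1) =>
        ENNReal.ofReal (v (τ - ε j) z.2) * ENNReal.ofReal (heatKernel z.2 τ (φ z.1)) := by
      refine (hvc.comp continuous_snd).measurable.ennreal_ofReal.mul
        (Measurable.ennreal_ofReal (Continuous.measurable ?_))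
      unfold heatKernel
      fun_prop
    calc ∫⁻ q, ENNReal.ofReal (f j q) ∂μ
        ≤ ∫⁻ q, (∫⁻ y, ENNReal.ofReal (v (τ - ε j) y) *
            ENNReal.ofReal (heatKernel y τ (φ q))) ∂μ := lintegral_mono hpw
      _ = ∫⁻ y, ∫⁻ q, ENNReal.ofReal (v (τ - ε j) y) *
            ENNReal.ofReal (heatKernel y τ (φ q)) ∂μ :=
          lintegral_lintegral_swap hjoint.aemeasurable
      _ ≤ ∫⁻ y, ENNReal.ofReal (v (τ - ε j) y) * ENNReal.ofReal (S / √(4 * Real.pi * τ)) := by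
          refine lintegral_mono fun y => ?_
          rw [lintegral_const_mul' _ _ ENNReal.ofReal_ne_top]
          exact mul_le_mul_right (lintegral_heatKernel_comp_le hφ hτ hS y) _
      _ ≤ 1 * ENNReal.ofReal (S / √(4 * Real.pi * τ)) := by
          rw [lintegral_mul_const' _ _ ENNReal.ofReal_ne_top]
          exact mul_le_mul_left (hv.lintegral_le_one hint hone ht) _
      _ = _ := one_mul _
  have hlim : ∀ q, Filter.Tendsto (fun j => ENNReal.ofReal (f j q)) Filter.atTop
      (nhds (ENNReal.ofReal (v 0 (φ q)))) := fun q =>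
    ENNReal.tendsto_ofReal
      ((tendsto_integral_mul_heatKernel hint hsm.continuous (φ q)).comp hε0)
  -- The smoothed functions converge pointwise to `v 0` on the image of `φ`, so Fatou carries the
  -- uniform bound to the limit.
  have hmain : ∫⁻ q, ENNReal.ofReal (v 0 (φ q)) ∂μ ≤ ENNReal.ofReal (S / √(4 * Real.pi * τ)) :=
    calc ∫⁻ q, ENNReal.ofReal (v 0 (φ q)) ∂μ
        = ∫⁻ q, Filter.liminf (fun j => ENNReal.ofReal (f j q)) Filter.atTop ∂μ :=
          lintegral_congr fun q => (hlim q).liminf_eq.symm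
      _ ≤ Filter.liminf (fun j => ∫⁻ q, ENNReal.ofReal (f j q) ∂μ) Filter.atTop :=
          lintegral_liminf_le hfm
      _ ≤ _ := Filter.liminf_le_of_frequently_le' (Filter.Frequently.of_forall hbound)
  unfold weightedArea
  rw [integral_eq_lintegral_of_nonneg_ae (Filter.Eventually.of_forall fun q => (hpos _).le)
    (hsm.continuous.comp hc).aestronglyMeasurable, mul_comm, ← le_div_iff₀ (by positivity)]
  exact ENNReal.toReal_le_of_le_ofReal (by positivity) hmain

end Huisken

/-! ### The main theorem. -/

theorem mainTheorem1 {n : ℕ} {M : Type*} [TopologicalSpace M] [ChartedSpace (Euc n) M]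
    [IsManifold (𝓡 n) ∞ M] [CompactSpace M] [T2Space M] [MeasurableSpace M] [BorelSpace M]
    (φ : M → Euc (n + 1)) (hφ : Manifold.IsImmersion (𝓡 n) (𝓡 (n + 1)) ∞ φ)
    (τ : ℝ) (hτ : 0 < τ) :
    (∀ u ∈ admissibleFamily (n + 1) τ,
      Integrable (fun q => u (φ q)) (inducedArea (n := n) φ)) ∧
    IsLUB (weightedArea φ τ '' admissibleFamily (n + 1) τ) (sigma φ τ) ∧
    IsGreatest (range (huiskenFunctional φ τ)) (sigma φ τ) ∧
    ∃ p : Euc (n + 1), heatKernel p τ ∈ admissibleFamily (n + 1) τ ∧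
      weightedArea φ τ (heatKernel p τ) = sigma φ τ := by

  have hsm : ContMDiff (𝓡 n) (𝓡 (n + 1)) ∞ φ := hφ.contMDiff
  obtain ⟨p, hp⟩ := exists_forall_huiskenFunctional_le hsm hτ
  have hmem := heatKernel_mem_admissibleFamily p hτ
  have hval : weightedArea φ τ (heatKernel p τ) = huiskenFunctional φ τ p :=
    (huiskenFunctional_eq_weightedArea φ hτ p).symm
  have hgreatest : IsGreatest (weightedArea φ τ '' admissibleFamily (n + 1) τ)
      (huiskenFunctional φ τ p) := by
    refine ⟨⟨_, hmem, hval⟩, ?_⟩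
    rintro _ ⟨u, hu, rfl⟩
    exact weightedArea_le hsm hτ hp hu
  -- A real `sSup` takes a default value on empty or unbounded sets; the greatest element shows that
  -- this one is a genuine supremum.
  have hsigma : sigma φ τ = huiskenFunctional φ τ p := hgreatest.csSup_eq
  rw [hsigma]
  refine ⟨fun u hu => integrable_comp_of_continuous hsm hu.1.continuous, hgreatest.isLUB,
    ⟨mem_range_self p, ?_⟩, p, hmem, hval⟩
  rintro _ ⟨q, rfl⟩
  exact hp q
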